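/- **Conventions.** Let $R$ be an associative ring with $1$, with an involution $a\mapsto\bar a$ (additive, $\overline{ab}=\bar b\bar a$, $\bar{\bar a}=a$), which is finitely generated as a module over its centre $C(R)$. Let $\lambda\in C(R)$ satisfy $\lambda\bar\lambda=1$ and let $\Lambda$ be a $\lambda$-form parameter on $R$: an additive subgroup with $\{a-\lambda\bar a: a\in R\}\subseteq\Lambda\subseteq\{a\in R: a=-\lambda\bar a\}$ and $\bar x\Lambda x\subseteq\Lambda$ for all $x\in R$. Let $J\subseteq R$ be a two-sided ideal with $\bar J=J$, and let $n\ge 3$. For such data put $\psi_n=\begin{pmatrix}0&I_n\\ \lambda I_n&0\end{pmatrix}$, let $\sigma^*$ denote the conjugate transpose of $\sigma$, and define $$GQ(2n,R,\Lambda,J)=\{\sigma\in GL_{2n}(R):\ \sigma^*\psi_n\sigma=\psi_n,\ \sigma\equiv I_{2n}\ (\mathrm{mod}\ J)\}.$$ With $\rho(i)=n+i$ for $1\le i\le n$, the elementary quadratic matrices are, for $1\le i,j\le n$, - $q\varepsilon_{ij}(a)=I_{2n}+a\,e_{ij}-\bar a\,e_{\rho(j)\rho(i)}$ for $i\ne j$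 and $a\in R$; - $qr_{ij}(a)=I_{2n}+a\,e_{i\rho(j)}-\bar\lambda\bar a\,e_{j\rho(i)}$ for $i\neq j$ and $a\in R$; $qr_{ii}(a)=I_{2n}+a\,e_{i\rho(i)}$ for $\bar a\in\Lambda$; - $ql_{ij}(a)=I_{2n}+a\,e_{\rho(i)j}-\lambda\bar a\,e_{\rho(j)i}$ for $i\ne j$ and $a\in R$; $ql_{ii}(a)=I_{2n}+a\,e_{\rho(i)i}$ for $a\in\Lambda$. The group $EQ(2n,R,\Lambda,J)$ is the subgroup of $GL_{2n}(R)$ generated by all $\eta(x)\,\eta'(a)\,\eta(x)^{-1}$, where $(\eta,\eta')$ is one of the pairs $(q\varepsilon_{ij},q\varepsilon_{ji})$ with $i\neq j$, $(qr_{ij},ql_{ji})$, $(ql_{ij},qr_{ji})$, and $x\in R$ and $a\in J$ are admissible arguments of $\eta$ and $\eta'$ respectively. Extend the involution to $R[X]$ by $\bar X=X$, let $\Lambda[X]$ be the set of polynomials with all coefficients in $\Lambda$, and let $J[X]$ be the extension of $J$ to $R[X]$; $(R[X],\Lambda[X])$ is a form ring with the same $\lambda$. For a maximal ideal $\mathfrak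 m$ of $C(R)$ let $S_{\mathfrak m}=\{s\in C(R): s\notin\mathfrak m,\ \bar s\notin\mathfrak m\}$, which is $C(R)\setminus\mathfrak m$ when $\bar{\mathfrak m}=\mathfrak m$, and put $R_{\mathfrak m}=S_{\mathfrak m}^{-1}R$ with the induced involution, $\Lambda_{\mathfrak m}=\{a/(\bar ss): a\in\Lambda,\ s\in S_{\mathfrak m}\}$ (the form parameter on $R_{\mathfrak m}$ generated by the image of $\Lambda$), and $J_{\mathfrak m}$ the extension of $J$ to $R_{\mathfrak m}$. Let $\alpha_{\mathfrak m}(X)$ be the image of a matrix $\alpha(X)$ over $R[X]$ in the matrices over $R_{\mathfrak m}[X]$. **Theorem (Relative L-G principle).** Let $\alpha(X)\in GQ(2n,R[X],\Lambda[X],J[X])$ with $\alpha(0)=I_{2n}$ be such that $\alpha_{\mathfrak m}(X)\in EQ(2n,R_{\mathfrak m}[X],\Lambda_{\mathfrak m}[X],J_{\mathfrak m}[X])$ for every maximal ideal $\mathfrak m$ of $C(R)$. Then $\alpha(X)\in EQ(2n,R[X],\Lambda[X],J[X])$. -/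

import Mathlib

open Polynomial

noncomputable section

namespace QuadraticGroup

/-! ### Form rings

The involution of `R` is the `star` operation of a `StarRing R`: it is additive, reverses products
and squares to the identity. -/

/-- A form ring structure `(λ, Λ)` on a ring `R` with involution: a central element `lam` with
`lam * star lam = 1`, and a `lam`-form parameter `Λ`, that is an additive subgroup with
`Λ_min ≤ Λ ≤ Λ_max` which is closed under `a ↦ star x * a * x`. -/
structure FormRing (R : Type*) [Ring R] [StarRing R] where
  lam : R
  lam_mem_center : lam ∈ Subring.center R
  lam_mul_star : lam * star lam = 1
  Λ : AddSubgroup R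
  min_mem : ∀ a : R, a - lam * star a ∈ Λ
  eq_of_mem : ∀ a ∈ Λ, a = -(lam * star a)
  conj_mem : ∀ x : R, ∀ a ∈ Λ, star x * a * x ∈ Λ

section Elementary

variable {R : Type*} [Ring R] [StarRing R]

/-- The matrix of the form `ψ_n = (0, I; λ I, 0)`. The index `i` is `Sum.inl i`, and
`ρ(i) = n + i` is `Sum.inr i`. -/
def psi (F : FormRing R) (n : ℕ) : Matrix (Fin n ⊕ Fin n) (Fin n ⊕ Fin n) R :=
  Matrix.fromBlocks 0 1 (Matrix.scalar (Fin n) F.lam) 0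

/-- The general quadratic group: all invertible `σ` with `σ* ψ_n σ = ψ_n`. -/
def GQ (F : FormRing R) (n : ℕ) : Subgroup (GL (Fin n ⊕ Fin n) R) where
  carrier := {σ | σ.val.conjTranspose * psi F n * σ.val = psi F n}
  one_mem' := by simp
  mul_mem' := by
    intro a b ha hb
    simp only [Set.mem_ofPred_eq] at ha hb ⊢
    calc (a * b).val.conjTranspose * psi F n * (a * b).val
        = b.val.conjTranspose * (a.val.conjTranspose * psi F n * a.val) * b.val := by
          simp only [Units.val_mul, Matrix.conjTranspose_mul, mul_assoc]
      _ = psi F n := by rw [ha, hb]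
  inv_mem' := by
    intro a ha
    simp only [Set.mem_ofPred_eq] at ha ⊢
    have h1 : a.val * (a⁻¹).val = 1 := a.mul_inv
    have h2 : (a⁻¹).val.conjTranspose * a.val.conjTranspose = 1 := by
      rw [← Matrix.conjTranspose_mul, h1, Matrix.conjTranspose_one]
    calc (a⁻¹).val.conjTranspose * psi F n * (a⁻¹).val
        = (a⁻¹).val.conjTranspose * (a.val.conjTranspose * psi F n * a.val) * (a⁻¹).val := by
          rw [ha]
      _ = ((a⁻¹).val.conjTranspose * a.val.conjTranspose) * psi F n *
            (a.val * (a⁻¹).val) := by simp only [mul_assoc]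
      _ = psi F n := by rw [h1, h2, one_mul, mul_one]

/-- The relative general quadratic group: the `σ` in the general quadratic group with
`σ ≡ I` modulo the two-sided ideal `J`. -/
def relGQ (F : FormRing R) (n : ℕ) (J : TwoSidedIdeal R) : Set (GL (Fin n ⊕ Fin n) R) :=
  {σ | σ ∈ GQ F n ∧
    ∀ i j, σ.val i j - (1 : Matrix (Fin n ⊕ Fin n) (Fin n ⊕ Fin n) R) i j ∈ J}

/-- The indices of the elementary generators: `ε i j` (with `i ≠ j`) for `qε_ij`,
`r i j` for `qr_ij` and `l i j` for `ql_ij`. -/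
inductive Idx (n : ℕ) : Type
  | ε (i j : Fin n) (h : i ≠ j) : Idx n
  | r (i j : Fin n) : Idx n
  | l (i j : Fin n) : Idx n

/-- Passing from `η_ij` to `η_ji`, that is from the matrix position of the argument to the
transposed position. -/
def Idx.opp {n : ℕ} : Idx n → Idx n
  | .ε i j h => .ε j i h.symm
  | .r i j => .l j i
  | .l i j => .r j i

/-- The arguments that an elementary generator admits: all of `R`, except that
`qr_ii(a)` needs `a` in the conjugate of `Λ` and `ql_ii(a)` needs `a` in `Λ`. -/
def Idx.arg (F : FormRing R) {n : ℕ} : Idx n → Set R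
  | .ε _ _ _ => Set.univ
  | .r i j => {a | i = j → star a ∈ F.Λ}
  | .l i j => {a | i = j → a ∈ F.Λ}

/-- The matrix `η(a) - I`. -/
def Idx.nil (F : FormRing R) {n : ℕ} : Idx n → R → Matrix (Fin n ⊕ Fin n) (Fin n ⊕ Fin n) R
  | .ε i j _, a =>
      Matrix.single (Sum.inl i) (Sum.inl j) a - Matrix.single (Sum.inr j) (Sum.inr i) (star a)
  | .r i j, a =>
      if i = j then Matrix.single (Sum.inl i) (Sum.inr i) a
      else Matrix.single (Sum.inl i) (Sum.inr j) a -
        Matrix.single (Sum.inl j) (Sum.inr i) (star F.lam * star a)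
  | .l i j, a =>
      if i = j then Matrix.single (Sum.inr i) (Sum.inl i) a
      else Matrix.single (Sum.inr i) (Sum.inl j) a -
        Matrix.single (Sum.inr j) (Sum.inl i) (F.lam * star a)

lemma Idx.nil_mul_nil (F : FormRing R) {n : ℕ} (p : Idx n) (a b : R) :
    p.nil F a * p.nil F b = 0 := by
  cases p with
  | ε i j h =>
    simp [Idx.nil, sub_mul, mul_sub, Matrix.single_mul_single_of_ne, h, h.symm]
  | r i j =>
    by_cases h : i = j <;>
      simp [Idx.nil, h, sub_mul, mul_sub, Matrix.single_mul_single_of_ne]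
  | l i j =>
    by_cases h : i = j <;>
      simp [Idx.nil, h, sub_mul, mul_sub, Matrix.single_mul_single_of_ne]

lemma Idx.nil_neg (F : FormRing R) {n : ℕ} (p : Idx n) (a : R) :
    p.nil F (-a) = -p.nil F a := by
  have hs : ∀ (i j : Fin n ⊕ Fin n) (c : R), Matrix.single i j (-c) = -Matrix.single i j c :=
    fun i j c => by ext k l; simp only [Matrix.single_apply, Matrix.neg_apply]; split_ifs <;> simp
  cases p with
  | ε i j h => simp only [Idx.nil, hs, star_neg]; abel
  | r i j => by_cases h : i = j <;> simp only [Idx.nil, h, hs, star_neg, mul_neg, if_true,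
      if_false]; abel
  | l i j => by_cases h : i = j <;> simp only [Idx.nil, h, hs, star_neg, mul_neg, if_true,
      if_false]; abel

/-- The elementary quadratic matrices `η(a)`:
`qε_ij(a) = I + a e_ij - ā e_{ρ(j)ρ(i)}` for `i ≠ j`,
`qr_ij(a) = I + a e_{iρ(j)} - λ̄ ā e_{jρ(i)}` for `i ≠ j` and `qr_ii(a) = I + a e_{iρ(i)}`,
`ql_ij(a) = I + a e_{ρ(i)j} - λ ā e_{ρ(j)i}` for `i ≠ j` and `ql_ii(a) = I + a e_{ρ(i)i}`. -/
def elem (F : FormRing R) {n : ℕ} (p : Idx n) (a : R) : GL (Fin n ⊕ Fin n) R where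
  val := 1 + p.nil F a
  inv := 1 + p.nil F (-a)
  val_inv := by
    rw [add_mul, mul_add, mul_add, p.nil_mul_nil, p.nil_neg]; simp
  inv_val := by
    rw [add_mul, mul_add, mul_add, p.nil_mul_nil, p.nil_neg]; simp

/-- The relative elementary quadratic group of the two-sided ideal `J`: the subgroup generated by
all `η_ij(x) η_ji(a) η_ij(x)⁻¹` with `x ∈ R` and `a ∈ J`. -/
def relEQ (F : FormRing R) (n : ℕ) (J : TwoSidedIdeal R) : Subgroup (GL (Fin n ⊕ Fin n) R) :=
  Subgroup.closure {g | ∃ (p : Idx n) (x a : R), x ∈ p.arg F ∧ a ∈ p.opp.arg F ∧ a ∈ J ∧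
    g = elem F p x * elem F p.opp a * (elem F p x)⁻¹}

end Elementary

/-! ### Polynomial rings -/

section Poly

variable {R : Type*} [Ring R] [StarRing R]

/-- The involution of `R[X]` that extends the one of `R` and fixes `X`. -/
instance polyStar : Star R[X] where
  star p := ∑ k ∈ p.support, monomial k (star (p.coeff k))

lemma coeff_star (p : R[X]) (k : ℕ) : (star p).coeff k = star (p.coeff k) := by
  change (∑ k ∈ p.support, monomial k (star (p.coeff k))).coeff k = _
  simp only [finsetSum_coeff, coeff_monomial, Finset.sum_ite_eq', mem_support_iff]
  by_cases h : p.coeff k = 0 <;> simp [h]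

instance polyStarRing : StarRing R[X] where
  star_involutive p := by ext k; simp only [coeff_star, star_star]
  star_add p q := by ext k; simp only [coeff_star, coeff_add, star_add]
  star_mul p q := by
    ext k
    rw [coeff_star, coeff_mul, coeff_mul, star_sum, ← Finset.Nat.sum_antidiagonal_swap]
    simp only [Prod.fst_swap, Prod.snd_swap, star_mul, coeff_star]

lemma star_C (a : R) : star (C a) = C (star a) := by
  ext k; rw [coeff_star, coeff_C, coeff_C]; split_ifs <;> simp

/-- The form ring `(R[X], Λ[X])`: the element `λ` is unchanged, and `Λ[X]` consists of the
polynomials all of whose coefficients are in `Λ`. -/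
def FormRing.poly (F : FormRing R) : FormRing R[X] where
  lam := C F.lam
  lam_mem_center := by
    rw [Subring.mem_center_iff]
    intro p
    ext k
    rw [coeff_C_mul, coeff_mul_C]
    exact Subring.mem_center_iff.1 F.lam_mem_center _
  lam_mul_star := by rw [star_C, ← C_mul, F.lam_mul_star, C_1]
  Λ :=
    { carrier := {p | ∀ k, p.coeff k ∈ F.Λ}
      zero_mem' := fun k => by simp
      add_mem' := fun hp hq k => by rw [coeff_add]; exact add_mem (hp k) (hq k)
      neg_mem' := fun hp k => by rw [coeff_neg]; exact neg_mem (hp k) }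
  min_mem p k := by
    rw [coeff_sub, coeff_C_mul, coeff_star]
    exact F.min_mem _
  eq_of_mem p hp := by
    ext k
    rw [coeff_neg, coeff_C_mul, coeff_star]
    exact F.eq_of_mem _ (hp k)
  conj_mem x a ha := by
    have hlam : ∀ p : R[X], C F.lam * p = p * C F.lam := by
      intro p
      ext k
      rw [coeff_C_mul, coeff_mul_C]
      exact (Subring.mem_center_iff.1 F.lam_mem_center _).symm
    have haa : a = -(C F.lam * star a) := by
      ext k
      rw [coeff_neg, coeff_C_mul, coeff_star]
      exact F.eq_of_mem _ (ha k)
    change ∀ k, (star x * a * x).coeff k ∈ F.Λ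
    induction x using Polynomial.induction_on' with
    | add p q hp hq =>
      intro k
      have e : star (p + q) * a * (p + q) = star p * a * p + star q * a * q +
          (star p * a * q - C F.lam * star (star p * a * q)) := by
        have : star q * a * p = -(C F.lam * star (star p * a * q)) := by
          conv_lhs => rw [haa]
          simp only [star_mul, star_star, mul_neg, neg_mul, ← mul_assoc]
          rw [hlam (star q)]
        rw [sub_eq_add_neg, ← this, star_add]
        noncomm_ring
      rw [e, coeff_add, coeff_add, coeff_sub, coeff_C_mul, coeff_star]
      exact add_mem (add_mem (hp k) (hq k)) (F.min_mem _)
    | monomial m r =>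
      intro k
      have hs : star (monomial m r) = X ^ m * C (star r) := by
        ext j
        rw [coeff_star, coeff_monomial, X_pow_mul_C, coeff_C_mul, coeff_X_pow]
        by_cases h : m = j <;> simp [h, eq_comm]
      have e : star (monomial m r) * a * monomial m r =
          C (star r) * a * C r * X ^ (m + m) := by
        rw [hs, ← C_mul_X_pow_eq_monomial, X_pow_mul_C, pow_add]
        simp only [mul_assoc]
        simp only [← mul_assoc, X_pow_mul]
        simp only [mul_assoc, X_pow_mul]
      rw [e, coeff_mul_X_pow']
      split_ifs
      · rw [coeff_mul_C, coeff_C_mul]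
        exact F.conj_mem _ _ (ha _)
      · exact zero_mem _

end Poly

/-! ### Localization at a maximal ideal of the centre -/

section Loc

variable {R : Type*} [Ring R] [StarRing R]

/-- The involution restricted to the centre. -/
def starCenter (c : Subring.center R) : Subring.center R :=
  ⟨star (c : R), Set.star_mem_center c.2⟩

/-- The multiplicative set at which we localize for a maximal ideal `m` of the centre `C(R)`: all
central `s` with `s ∉ m` and `star s ∉ m`. If `m` is invariant under the involution, this is
`C(R) \ m`. In general it is the largest subset of `C(R) \ m` that is invariant under the
involution, as it has to be for the localization to inherit an involution. -/
def locSet (m : MaximalSpectrum (Subring.center R)) : Submonoid (Subring.center R) where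
  carrier := {s | s ∉ m.asIdeal ∧ starCenter s ∉ m.asIdeal}
  one_mem' := by
    have h1 : (1 : Subring.center R) ∉ m.asIdeal :=
      fun h => m.isMaximal.ne_top ((Ideal.eq_top_iff_one _).2 h)
    have h2 : starCenter (1 : Subring.center R) = 1 := Subtype.ext (by simp [starCenter])
    exact ⟨h1, by rw [h2]; exact h1⟩
  mul_mem' := by
    rintro a b ⟨ha, ha'⟩ ⟨hb, hb'⟩
    have hp : m.asIdeal.IsPrime := m.isMaximal.isPrime
    have h : starCenter (a * b) = starCenter b * starCenter a :=
      Subtype.ext (by simp [starCenter])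
    exact ⟨fun hab => (hp.mem_or_mem hab).elim ha hb,
      fun hab => (hp.mem_or_mem (h ▸ hab)).elim hb' ha'⟩

/-- The involution on the multiplicative set. -/
def starLoc {m : MaximalSpectrum (Subring.center R)} (s : locSet m) : locSet m :=
  ⟨starCenter s.1, s.2.2, by
    have : starCenter (starCenter s.1) = s.1 := Subtype.ext (by simp [starCenter])
    rw [this]; exact s.2.1⟩

/-- The localization `R_m`, as a ring of fractions with denominators in `locSet m`. -/
abbrev Loc (m : MaximalSpectrum (Subring.center R)) : Type _ := LocalizedModule (locSet m) R

/-- The localization homomorphism `a ↦ a / 1`. -/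
def toLoc (m : MaximalSpectrum (Subring.center R)) : R →+* Loc m where
  toFun a := LocalizedModule.mk a 1
  map_one' := OreLocalization.one_def.symm
  map_mul' a b := by rw [LocalizedModule.mk_mul_mk, one_mul]
  map_zero' := LocalizedModule.zero_mk 1
  map_add' a b := by rw [LocalizedModule.mk_add_mk, one_smul, one_smul, one_mul]

variable {m : MaximalSpectrum (Subring.center R)}

lemma smul_eq (s : locSet m) (a : R) : s • a = ((s : Subring.center R) : R) * a := rfl

lemma smul_eq' (s : locSet m) (a : R) : s • a = a * ((s : Subring.center R) : R) :=
  (Subring.mem_center_iff.1 s.1.2 a).symm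

lemma star_smul_loc (s : locSet m) (a : R) : star (s • a) = starLoc s • star a := by
  rw [smul_eq', smul_eq, star_mul]; rfl

lemma starLoc_starLoc (s : locSet m) : starLoc (starLoc s) = s :=
  Subtype.ext (Subtype.ext (by simp [starLoc, starCenter]))

lemma starLoc_mul (s t : locSet m) : starLoc (s * t) = starLoc s * starLoc t := by
  rw [mul_comm s t]
  exact Subtype.ext (Subtype.ext (by simp [starLoc, starCenter]))

/-- The involution of `R_m`, with `a / s ↦ ā / s̄`. -/
instance locStar : Star (Loc m) where
  star x := LocalizedModule.liftOn x (fun p => LocalizedModule.mk (star p.1) (starLoc p.2)) (by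
    rintro ⟨a, s⟩ ⟨b, t⟩ ⟨u, hu⟩
    refine LocalizedModule.mk_eq.2 ⟨starLoc u, ?_⟩
    have := congrArg star hu
    simpa only [star_smul_loc] using this)

lemma star_mk (a : R) (s : locSet m) :
    star (LocalizedModule.mk a s : Loc m) = LocalizedModule.mk (star a) (starLoc s) :=
  LocalizedModule.liftOn_mk _ a s

instance locStarRing : StarRing (Loc m) where
  star_involutive x := by
    induction x using LocalizedModule.induction_on with
    | h a s => rw [star_mk, star_mk, star_star, starLoc_starLoc]
  star_mul x y := by
    induction x, y using LocalizedModule.induction_on₂ with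
    | h a b s t =>
      rw [star_mk, star_mk, LocalizedModule.mk_mul_mk, star_mk, LocalizedModule.mk_mul_mk,
        star_mul, starLoc_mul, mul_comm (starLoc s)]
  star_add x y := by
    induction x, y using LocalizedModule.induction_on₂ with
    | h a b s t =>
      rw [star_mk, star_mk, LocalizedModule.mk_add_mk, star_mk, LocalizedModule.mk_add_mk,
        star_add, star_smul_loc, star_smul_loc, starLoc_mul]

/-- The norm `s̄ s` of a denominator. -/
def normLoc (s : locSet m) : locSet m := starLoc s * s

lemma starLoc_normLoc (s : locSet m) : starLoc (normLoc s) = normLoc s := by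
  rw [normLoc, starLoc_mul, starLoc_starLoc, mul_comm]

lemma normLoc_smul (s : locSet m) (a : R) :
    normLoc s • a = star ((s : Subring.center R) : R) * a * ((s : Subring.center R) : R) := by
  rw [normLoc, mul_smul, smul_eq' s, smul_eq, ← mul_assoc]; rfl

lemma mk_smul_mul (s t : locSet m) (a : R) :
    (LocalizedModule.mk (s • a) (s * t) : Loc m) = LocalizedModule.mk a t :=
  LocalizedModule.mk_eq.2 ⟨1, by
    rw [one_smul, one_smul, smul_smul, mul_comm t s]⟩

/-- The form ring `(R_m, Λ_m)`. A form parameter is not closed under multiplication by all central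
elements, only by the norms `s̄ s` of such elements, so `Λ_m` consists of the fractions
`a / (s̄ s)` with `a ∈ Λ`; this is the form parameter on `R_m` generated by the image of `Λ`. -/
def FormRing.loc (F : FormRing R) (m : MaximalSpectrum (Subring.center R)) : FormRing (Loc m) where
  lam := toLoc m F.lam
  lam_mem_center := by
    rw [Subring.mem_center_iff]
    intro x
    induction x using LocalizedModule.induction_on with
    | h a s =>
      change LocalizedModule.mk a s * LocalizedModule.mk F.lam 1 =
        LocalizedModule.mk F.lam 1 * LocalizedModule.mk a s
      rw [LocalizedModule.mk_mul_mk, LocalizedModule.mk_mul_mk, one_mul, mul_one,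
        Subring.mem_center_iff.1 F.lam_mem_center]
  lam_mul_star := by
    have h1 : starLoc (1 : locSet m) = 1 :=
      Subtype.ext (Subtype.ext (by simp [starLoc, starCenter]))
    change LocalizedModule.mk F.lam 1 * star (LocalizedModule.mk F.lam 1) = _
    rw [star_mk, LocalizedModule.mk_mul_mk, F.lam_mul_star, h1, one_mul]
    exact OreLocalization.one_def.symm
  Λ :=
    { carrier := {x | ∃ a ∈ F.Λ, ∃ s : locSet m, x = LocalizedModule.mk a (normLoc s)}
      zero_mem' := ⟨0, zero_mem _, 1, (LocalizedModule.zero_mk _).symm⟩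
      add_mem' := by
        rintro _ _ ⟨a, ha, s, rfl⟩ ⟨b, hb, t, rfl⟩
        refine ⟨normLoc t • a + normLoc s • b, ?_, s * t, ?_⟩
        · rw [normLoc_smul, normLoc_smul]
          exact add_mem (F.conj_mem _ _ ha) (F.conj_mem _ _ hb)
        · rw [LocalizedModule.mk_add_mk]
          congr 1
          simp only [normLoc, starLoc_mul]
          exact mul_mul_mul_comm _ _ _ _
      neg_mem' := by
        rintro _ ⟨a, ha, s, rfl⟩
        exact ⟨-a, neg_mem ha, s, LocalizedModule.mk_neg.symm⟩ }
  min_mem x := by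
    induction x using LocalizedModule.induction_on with
    | h a s =>
      refine ⟨starLoc s • a - F.lam * star (starLoc s • a), F.min_mem _, s, ?_⟩
      rw [← mk_smul_mul (starLoc s) s a]
      change _ - LocalizedModule.mk F.lam 1 * star (LocalizedModule.mk _ (normLoc s)) = _
      rw [star_mk, starLoc_normLoc, LocalizedModule.mk_mul_mk, one_mul, sub_eq_add_neg,
        ← LocalizedModule.mk_neg, LocalizedModule.mk_add_mk]
      change LocalizedModule.mk (normLoc s • _ + normLoc s • _) (normLoc s * normLoc s) = _
      rw [← smul_add, mk_smul_mul, ← sub_eq_add_neg]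
  eq_of_mem := by
    rintro _ ⟨a, ha, s, rfl⟩
    change _ = -(LocalizedModule.mk F.lam 1 * star (LocalizedModule.mk a (normLoc s)))
    rw [star_mk, starLoc_normLoc, LocalizedModule.mk_mul_mk, one_mul, ← LocalizedModule.mk_neg,
      ← F.eq_of_mem a ha]
  conj_mem x := by
    rintro _ ⟨a, ha, s, rfl⟩
    induction x using LocalizedModule.induction_on with
    | h b t =>
      refine ⟨star b * a * b, F.conj_mem _ _ ha, s * t, ?_⟩
      rw [star_mk, LocalizedModule.mk_mul_mk, LocalizedModule.mk_mul_mk]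
      congr 1
      simp only [normLoc, starLoc_mul]
      ac_rfl

end Loc

end QuadraticGroup

end

open scoped commutatorElement

set_option linter.unusedSectionVars false

noncomputable section

namespace QuadraticGroup

/-! ### Root elements -/

section Roots

variable {R : Type*} [Ring R] [StarRing R] {n : ℕ}

/-! The relative statement is deduced from an absolute one over another ring. Let `D` be the double
of `R` along `J`, the ring of pairs congruent modulo `J`, with componentwise involution and form
parameter. A matrix `α ≡ 1` modulo `J[X]` is the same as a matrix `β = (α, 1)` over `D[X]`
(`exists_glMap_eq`). A generator `η(x) η'(a) η(x)⁻¹` of the relative group lifts to the elementary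
group of the double with arguments `(x, x)` and `(a, 0)` (`exists_lift_of_mem_relEQ`), so `β` is
locally elementary in the absolute sense. The absolute local-global principle over `D` makes `β`
elementary. Conversely, if `g` is elementary over `D[X]`, then its first projection times the
inverse of its second lies in the relative group (`fst_mul_snd_inv_mem`). This uses that the
relative group is normalized by the absolute one (`conjGrp_normal`), where `n ≥ 3` enters.

The absolute principle is Quillen's patching (`mem_eqGrp_of_local`). The scalars `b` modulo which
congruent substitutions `X ↦ cX` change `g` only by elementary factors form an ideal, and the
dilation principle (`IsFormLoc.dilation`, `IsFormLoc.exists_congruent`) puts an element outside any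
given maximal ideal into it. Dilation itself rests on clearing denominators: an elementary matrix
over the localization conjugates root elements whose arguments are divisible by a high enough scalar
into root elements that come from the base ring (`IsFormLoc.exists_conj`).

A general central element may fail to preserve `Λ`, so the only scalars used are the central
symmetric ones that do (`FormRing.scalars`). They include the norms `c̄ c` and traces `c + c̄`.
Hence every fraction can be given an admissible denominator (`isFormLoc_toLoc`), and the centre is
integral over the scalars, so each maximal ideal of scalars lies under one of the centre.

All three kinds of generators are treated as root elements `rootT F i j a` at `e_i + e_j` of type
`C_n`, with `e_ρ(i) = -e_i`; the roots with `i = j` are long. The commutator formulas are used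
mainly through linear functionals `w` on the roots (`Level.commutator_mem`, `exists_weight`). -/

lemma FormRing.lam_comm (F : FormRing R) (a : R) : F.lam * a = a * F.lam :=
  (Subring.mem_center_iff.1 F.lam_mem_center a).symm

lemma FormRing.star_lam_comm (F : FormRing R) (a : R) : star F.lam * a = a * star F.lam := by
  have := congrArg star (F.lam_comm (star a))
  simpa using this.symm

lemma FormRing.star_mul_lam (F : FormRing R) : star F.lam * F.lam = 1 := by
  rw [F.star_lam_comm, F.lam_mul_star]

lemma FormRing.lam_mul_star_mul (F : FormRing R) (a : R) : F.lam * (star F.lam * a) = a := by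
  rw [← mul_assoc, F.lam_mul_star, one_mul]

lemma FormRing.star_mul_lam_mul (F : FormRing R) (a : R) : star F.lam * (F.lam * a) = a := by
  rw [← mul_assoc, F.star_mul_lam, one_mul]

/-- The twisted conjugate `λ̄ ā`. -/
def FormRing.tw (F : FormRing R) (a : R) : R := star F.lam * star a

lemma FormRing.tw_neg (F : FormRing R) (a : R) : F.tw (-a) = -F.tw a := by simp [tw]

lemma FormRing.tw_add (F : FormRing R) (a b : R) : F.tw (a + b) = F.tw a + F.tw b := by
  simp [tw, mul_add]

lemma FormRing.tw_tw (F : FormRing R) (a : R) : F.tw (F.tw a) = a := by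
  simp only [tw, star_mul, star_star]
  rw [← F.lam_comm, ← mul_assoc, F.star_mul_lam, one_mul]

/-- The twisted conjugate of an argument of a long root element. -/
lemma FormRing.tw_eq_neg (F : FormRing R) {a : R} (ha : star a ∈ F.Λ) : F.tw a = -a := by
  have h := F.eq_of_mem _ ha
  rw [star_star] at h
  rw [tw, h, mul_neg, ← mul_assoc, F.star_mul_lam, one_mul]

/-- The value `h(e_i, e_ρ(i))` of the form. -/
def FormRing.nu (F : FormRing R) : Fin n ⊕ Fin n → R := Sum.elim (fun _ => 1) (fun _ => F.lam)

lemma FormRing.nu_comm (F : FormRing R) (i : Fin n ⊕ Fin n) (a : R) :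
    F.nu i * a = a * F.nu i := by
  cases i <;> simp [nu, F.lam_comm]

lemma FormRing.star_nu_comm (F : FormRing R) (i : Fin n ⊕ Fin n) (a : R) :
    star (F.nu i) * a = a * star (F.nu i) := by
  cases i <;> simp [nu, F.star_lam_comm]

lemma FormRing.star_nu_mul (F : FormRing R) (i : Fin n ⊕ Fin n) :
    star (F.nu i) * F.nu i = 1 := by
  cases i <;> simp [nu, F.star_mul_lam]

lemma FormRing.nu_swap (F : FormRing R) (i : Fin n ⊕ Fin n) :
    F.nu i.swap = F.lam * star (F.nu i) := by
  cases i <;> simp [nu, F.lam_mul_star]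

/-- The matrix `e_i a h(e_j, -)`. -/
def rootX (F : FormRing R) (i j : Fin n ⊕ Fin n) (a : R) :
    Matrix (Fin n ⊕ Fin n) (Fin n ⊕ Fin n) R := Matrix.single i j.swap (a * F.nu j)

lemma rootX_add (F : FormRing R) (i j : Fin n ⊕ Fin n) (a b : R) :
    rootX F i j (a + b) = rootX F i j a + rootX F i j b := by
  simp [rootX, add_mul, Matrix.single_add]

lemma rootX_zero (F : FormRing R) (i j : Fin n ⊕ Fin n) : rootX F i j 0 = 0 := by
  simp [rootX]

lemma rootX_neg (F : FormRing R) (i j : Fin n ⊕ Fin n) (a : R) :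
    rootX F i j (-a) = -rootX F i j a := by
  rw [eq_neg_iff_add_eq_zero, ← rootX_add, neg_add_cancel, rootX_zero]

lemma rootX_sub (F : FormRing R) (i j : Fin n ⊕ Fin n) (a b : R) :
    rootX F i j (a - b) = rootX F i j a - rootX F i j b := by
  rw [sub_eq_add_neg, rootX_add, rootX_neg, sub_eq_add_neg]

lemma rootX_mul (F : FormRing R) (i j k l : Fin n ⊕ Fin n) (a b : R) :
    rootX F i j a * rootX F k l b = if j.swap = k then rootX F i l (a * F.nu j * b) else 0 := by
  split_ifs with h
  · subst h
    simp [rootX, mul_assoc]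
  · exact Matrix.single_mul_single_of_ne _ _ _ _ h _

/-- The nilpotent part of a root element. -/
def rootN (F : FormRing R) (i j : Fin n ⊕ Fin n) (a : R) :
    Matrix (Fin n ⊕ Fin n) (Fin n ⊕ Fin n) R :=
  if i = j then rootX F i i a else rootX F i j a - rootX F j i (F.tw a)

lemma rootN_add (F : FormRing R) (i j : Fin n ⊕ Fin n) (a b : R) :
    rootN F i j (a + b) = rootN F i j a + rootN F i j b := by
  unfold rootN
  split_ifs
  · exact rootX_add ..
  · rw [rootX_add, F.tw_add, rootX_add]; abel

lemma rootN_mul_self (F : FormRing R) {i j : Fin n ⊕ Fin n} (h : j ≠ i.swap) (a b : R) :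
    rootN F i j a * rootN F i j b = 0 := by
  have h1 : i.swap ≠ i := by cases i <;> simp
  have h2 : j.swap ≠ j := by cases j <;> simp
  have h3 : i.swap ≠ j := h.symm
  have h4 : j.swap ≠ i := fun e => h (by rw [← e, Sum.swap_swap])
  unfold rootN
  split_ifs <;> simp [mul_sub, sub_mul, rootX_mul, h1, h2, h3, h4]

/-- The root element of the root `e_i + e_j`; it is `1` if `j = ρ(i)`. -/
def rootT (F : FormRing R) (i j : Fin n ⊕ Fin n) (a : R) : GL (Fin n ⊕ Fin n) R :=
  if h : j = i.swap then 1 else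
  { val := 1 + rootN F i j a
    inv := 1 - rootN F i j a
    val_inv := by simp [add_mul, mul_sub, rootN_mul_self F h]
    inv_val := by simp [sub_mul, mul_add, rootN_mul_self F h] }

lemma rootT_val (F : FormRing R) {i j : Fin n ⊕ Fin n} (h : j ≠ i.swap) (a : R) :
    (rootT F i j a).val = 1 + rootN F i j a := by
  simp [rootT, h]

lemma rootT_inv_val (F : FormRing R) {i j : Fin n ⊕ Fin n} (h : j ≠ i.swap) (a : R) :
    ((rootT F i j a)⁻¹).val = 1 - rootN F i j a := by
  simp only [rootT, h, dite_false]; rfl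

lemma rootT_add (F : FormRing R) (i j : Fin n ⊕ Fin n) (a b : R) :
    rootT F i j (a + b) = rootT F i j a * rootT F i j b := by
  by_cases h : j = i.swap
  · simp [rootT, h]
  · ext1
    rw [Units.val_mul, rootT_val F h, rootT_val F h, rootT_val F h, rootN_add]
    simp only [add_mul, mul_add, rootN_mul_self F h]
    simp; abel

lemma rootT_zero (F : FormRing R) (i j : Fin n ⊕ Fin n) : rootT F i j 0 = 1 := by
  simpa using rootT_add F i j 0 0

lemma rootT_neg (F : FormRing R) (i j : Fin n ⊕ Fin n) (a : R) :
    rootT F i j (-a) = (rootT F i j a)⁻¹ := by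
  rw [eq_inv_iff_mul_eq_one, ← rootT_add, neg_add_cancel, rootT_zero]

lemma rootT_flip (F : FormRing R) {i j : Fin n ⊕ Fin n} (h : i ≠ j) (a : R) :
    rootT F i j a = rootT F j i (-F.tw a) := by
  by_cases hj : j = i.swap
  · simp [rootT, hj]
  · have hi : i ≠ j.swap := fun e => hj (by rw [e, Sum.swap_swap])
    ext1
    rw [rootT_val F hj, rootT_val F hi]
    simp only [rootN, h, h.symm, if_false, F.tw_neg, F.tw_tw, rootX_neg]
    abel

/-- The roles are not symmetric: `P * Q * P` must vanish, while `Q * P * Q` may survive. When a long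
root is involved it therefore has to be the first entry of the commutator, and `Q * P * Q` is then
the extra long root factor. -/
lemma one_add_commutator {M : Type*} [Ring M] {P Q : M} (hP : P * P = 0) (hQ : Q * Q = 0)
    (hPQ : P * Q * P = 0) :
    (1 + P) * (1 + Q) * (1 - P) * (1 - Q) = 1 + P * Q - Q * P + Q * P * Q := by
  have e : (1 + P) * (1 + Q) * (1 - P) * (1 - Q) = 1 + P * Q - Q * P + Q * P * Q
      - P * P + (P * P) * Q - Q * Q - P * (Q * Q) - P * Q * P + (P * Q * P) * Q := by
    noncomm_ring
  rw [e, hP, hQ, hPQ]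
  simp

lemma commutator_rootT_val (F : FormRing R) {i j k l : Fin n ⊕ Fin n} (hp : j ≠ i.swap)
    (hq : l ≠ k.swap) {a b : R} (h : rootN F i j a * rootN F k l b * rootN F i j a = 0) :
    (⁅rootT F i j a, rootT F k l b⁆).val = 1 + rootN F i j a * rootN F k l b -
      rootN F k l b * rootN F i j a + rootN F k l b * rootN F i j a * rootN F k l b := by
  rw [commutatorElement_def, Units.val_mul, Units.val_mul, Units.val_mul, rootT_val F hp,
    rootT_val F hq, rootT_inv_val F hp, rootT_inv_val F hq]
  exact one_add_commutator (rootN_mul_self F hp _ _) (rootN_mul_self F hq _ _) h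

lemma tw_mul (F : FormRing R) (j : Fin n ⊕ Fin n) (a b : R) :
    F.tw b * F.nu j.swap * F.tw a = F.tw (a * F.nu j * b) := by
  simp only [FormRing.tw, F.nu_swap, star_mul]
  rw [F.star_lam_comm (star a), ← F.star_nu_comm]
  simp only [mul_assoc]
  rw [F.lam_comm]
  simp only [mul_assoc, F.star_mul_lam, mul_one]

section Relations

variable (F : FormRing R) {i j l : Fin n ⊕ Fin n}

lemma swap_ne_self (i : Fin n ⊕ Fin n) : i.swap ≠ i := by cases i <;> simp

lemma swap_eq_iff {i j : Fin n ⊕ Fin n} : i.swap = j ↔ i = j.swap :=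
  ⟨fun h => by rw [← h, Sum.swap_swap], fun h => by rw [h, Sum.swap_swap]⟩

lemma commutator_short (hij : i ≠ j) (hij' : j ≠ i.swap) (hil : i ≠ l) (hil' : l ≠ i.swap)
    (hjl : l ≠ j) (hjl' : l ≠ j.swap) (a b : R) :
    ⁅rootT F i j a, rootT F j.swap l b⁆ = rootT F i l (a * F.nu j * b) := by
  have e4 : i.swap ≠ j.swap := fun h => hij (Sum.swap_leftInverse.injective h)
  have e7 : l.swap ≠ i := fun h => hil' (swap_eq_iff.1 h)
  have e8 : l.swap ≠ j := fun h => hjl' (swap_eq_iff.1 h)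
  have e10 : l ≠ j.swap.swap := by rwa [Sum.swap_swap]
  ext1
  rw [commutator_rootT_val F hij' e10, rootT_val F hil']
  all_goals
    simp [rootN, mul_sub, sub_mul, rootX_mul, tw_mul, hij, hil, hij.symm, hil'.symm,
      hjl'.symm, e4, e7, e8]
  abel

lemma commutator_short_short (hij : i ≠ j) (hij' : j ≠ i.swap) (a b : R) :
    ⁅rootT F i j a, rootT F j.swap i b⁆ =
      rootT F i i (a * F.nu j * b - F.tw (a * F.nu j * b)) := by
  have e1 := swap_ne_self i
  have e4 : i.swap ≠ j.swap := fun h => hij (Sum.swap_leftInverse.injective h)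
  have e9 : j.swap ≠ i := fun h => hij' (swap_eq_iff.1 h)
  have e10 : i ≠ j.swap.swap := by rwa [Sum.swap_swap]
  ext1
  rw [commutator_rootT_val F hij' e10, rootT_val F e1.symm]
  all_goals
    simp [rootN, mul_sub, sub_mul, rootX_mul, tw_mul, hij, hij.symm, rootX_sub,
      hij'.symm, e1, e4, e9]
  abel

/-- The second factor is the term quadratic in `b`, at the long root `2 e_l`. The condition on `a`
turns its twisted conjugate into `-a`, so that the linear terms combine into one short root element.
-/
lemma commutator_long (hil : i ≠ l) (hil' : l ≠ i.swap) {a : R} (ha : star a ∈ F.Λ) (b : R) :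
    ⁅rootT F i i a, rootT F i.swap l b⁆ =
      rootT F i l (a * F.nu i * b) * rootT F l l (-(star (F.nu i * b) * a * (F.nu i * b))) := by
  have e1 := swap_ne_self i
  have e3 := swap_ne_self l
  have e7 : l.swap ≠ i := fun h => hil' (swap_eq_iff.1 h)
  have e10 : l ≠ i.swap.swap := by rw [Sum.swap_swap]; exact hil.symm
  have h1 : F.tw b * F.nu i.swap * a = -F.tw (a * F.nu i * b) := by
    rw [← tw_mul, F.tw_eq_neg ha, mul_neg, neg_neg]
  have h2 : star (F.nu i * b) * a * (F.nu i * b) = F.tw b * F.nu i.swap * a * F.nu i * b := by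
    rw [F.nu_swap, FormRing.tw, star_mul, F.star_lam_comm (star b)]
    simp only [mul_assoc]
    rw [F.star_mul_lam_mul]
  rw [h2, h1]
  ext1
  rw [commutator_rootT_val F e1.symm e10, Units.val_mul, rootT_val F hil', rootT_val F e3.symm]
  all_goals
    simp [rootN, mul_sub, sub_mul, mul_add, add_mul, rootX_mul, hil, rootX_neg,
      hil'.symm, e3, e7, h1]
  abel

lemma commutator_eq_one {k : Fin n ⊕ Fin n} (hij : j ≠ i.swap) (hkl : l ≠ k.swap)
    (h1 : k ≠ i.swap) (h2 : k ≠ j.swap) (h3 : l ≠ i.swap) (h4 : l ≠ j.swap) (a b : R) :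
    ⁅rootT F i j a, rootT F k l b⁆ = 1 := by
  have e1 : k.swap ≠ i := fun h => h1 (swap_eq_iff.1 h)
  have e2 : k.swap ≠ j := fun h => h2 (swap_eq_iff.1 h)
  have e3 : l.swap ≠ i := fun h => h3 (swap_eq_iff.1 h)
  have e4 : l.swap ≠ j := fun h => h4 (swap_eq_iff.1 h)
  have hP : rootN F i j a * rootN F k l b = 0 := by
    unfold rootN
    split_ifs <;> simp [mul_sub, sub_mul, rootX_mul, h1.symm, h2.symm, h3.symm, h4.symm]
  have hQ : rootN F k l b * rootN F i j a = 0 := by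
    unfold rootN
    split_ifs <;> simp [mul_sub, sub_mul, rootX_mul, e1, e2, e3, e4]
  ext1
  rw [commutator_rootT_val F hij hkl] <;> simp [hP, hQ]

end Relations

end Roots

/-! ### Levels of arguments, weights and the commutator formula -/

section Levels

variable {R : Type*} [Ring R] [StarRing R] {n : ℕ}

/-- A level: additive groups `M` and `L` of admitted arguments of the short and of the long root
elements. -/
structure Level (F : FormRing R) where
  M : AddSubgroup R
  L : AddSubgroup R
  le : L ≤ M
  star_mem_Λ : ∀ a ∈ L, star a ∈ F.Λ
  lam_mul_mem : ∀ a ∈ M, F.lam * a ∈ M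
  star_mem : ∀ a ∈ M, star a ∈ M
  sub_tw_mem : ∀ a ∈ M, a - F.tw a ∈ L

namespace Level

variable {F : FormRing R} (V : Level F)

/-- The condition on the argument of the root element at `e_i + e_j`. -/
def Adm (i j : Fin n ⊕ Fin n) (a : R) : Prop := a ∈ V.M ∧ (i = j → a ∈ V.L)

/-- The group generated by the root elements at roots in `Φ` with arguments of level `V`. -/
def grp (Φ : (Fin n ⊕ Fin n) → (Fin n ⊕ Fin n) → Prop) : Subgroup (GL (Fin n ⊕ Fin n) R) :=
  Subgroup.closure {g | ∃ i j a, j ≠ i.swap ∧ V.Adm i j a ∧ Φ i j ∧ g = rootT F i j a}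

variable {V}

lemma grp_mono {V W : Level F} {Φ Ψ : (Fin n ⊕ Fin n) → (Fin n ⊕ Fin n) → Prop}
    (hM : V.M ≤ W.M) (hL : V.L ≤ W.L) (h : ∀ i j, Φ i j → Ψ i j) : V.grp Φ ≤ W.grp Ψ := by
  refine Subgroup.closure_mono ?_
  rintro _ ⟨i, j, a, h1, h2, h3, rfl⟩
  exact ⟨i, j, a, h1, ⟨hM h2.1, fun e => hL (h2.2 e)⟩, h _ _ h3, rfl⟩

lemma rootT_mem_grp {Φ : (Fin n ⊕ Fin n) → (Fin n ⊕ Fin n) → Prop} {i j : Fin n ⊕ Fin n} {a : R}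
    (h : V.Adm i j a) (hΦ : j ≠ i.swap → Φ i j) : rootT F i j a ∈ V.grp Φ := by
  by_cases hj : j = i.swap
  · simp [rootT, hj, one_mem]
  · exact Subgroup.subset_closure ⟨i, j, a, hj, h, hΦ hj, rfl⟩

lemma star_lam_mul_mem {a : R} (h : a ∈ V.M) : star F.lam * a ∈ V.M := by
  have := V.star_mem _ (V.lam_mul_mem _ (V.star_mem _ h))
  rwa [star_mul, star_star, ← F.star_lam_comm] at this

lemma tw_mem {a : R} (h : a ∈ V.M) : F.tw a ∈ V.M := star_lam_mul_mem (V.star_mem _ h)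

lemma nu_mul_mem {a : R} (h : a ∈ V.M) (i : Fin n ⊕ Fin n) : F.nu i * a ∈ V.M := by
  cases i
  · simpa [FormRing.nu] using h
  · exact V.lam_mul_mem _ h

lemma Adm.neg {i j : Fin n ⊕ Fin n} {a : R} (h : V.Adm i j a) : V.Adm i j (-a) :=
  ⟨neg_mem h.1, fun e => neg_mem (h.2 e)⟩

/-- The products that occur in the commutator relations are of level `V`; the propositions `P` and
`Q` say that `a` and `b` are arguments of long root elements. -/
structure Mul (V : Level F) (P Q : Prop) (a b : R) : Prop where
  mul : a * b ∈ V.M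
  mul_rev : b * a ∈ V.M
  mulStar : a * star b ∈ V.M
  starMul : star a * b ∈ V.M
  conj_left : P → star b * a * b ∈ V.L ∧ b * a * star b ∈ V.L
  conj_right : Q → star a * b * a ∈ V.L ∧ a * b * star a ∈ V.L

lemma Mul.symm {P Q : Prop} {a b : R} (h : V.Mul P Q a b) : V.Mul Q P b a where
  mul := h.mul_rev
  mul_rev := h.mul
  mulStar := by simpa using V.star_mem _ h.mulStar
  starMul := by simpa using V.star_mem _ h.starMul
  conj_left := h.conj_right
  conj_right := h.conj_left

/-- Exchanging the indices of a root replaces `a` by `-λ̄ ā`. The conditions survive because they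
come in pairs exchanged by the involution, and because `λ` cancels in the quadratic terms. -/
lemma Mul.flip {P P' Q : Prop} {a b : R} (h : V.Mul P Q a b) (hP : P' → P)
    (ha : P → star a ∈ F.Λ) : V.Mul P' Q (-F.tw a) b where
  mul := by
    rw [neg_mul, FormRing.tw, mul_assoc]
    exact neg_mem (star_lam_mul_mem h.starMul)
  mul_rev := by
    rw [mul_neg, FormRing.tw, ← mul_assoc, ← F.star_lam_comm, mul_assoc]
    exact neg_mem (star_lam_mul_mem h.symm.mulStar)
  mulStar := by
    rw [neg_mul, FormRing.tw, mul_assoc, ← star_mul]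
    exact neg_mem (star_lam_mul_mem (V.star_mem _ h.mul_rev))
  starMul := by
    rw [star_neg, neg_mul, FormRing.tw, star_mul, star_star, star_star, ← F.lam_comm, mul_assoc]
    exact neg_mem (V.lam_mul_mem _ h.mul)
  conj_left hp := by
    rw [F.tw_eq_neg (ha (hP hp)), neg_neg]
    exact h.conj_left (hP hp)
  conj_right hb := by
    have e1 : star (F.tw a) * b * F.tw a = a * b * star a := by
      rw [FormRing.tw, star_mul, star_star, star_star, mul_assoc, mul_assoc, F.lam_comm]
      simp only [mul_assoc]
      rw [← F.lam_comm, F.star_mul_lam_mul]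
    have e2 : F.tw a * b * star (F.tw a) = star a * b * a := by
      rw [FormRing.tw, star_mul, star_star, star_star, mul_assoc, mul_assoc, F.star_lam_comm]
      simp only [mul_assoc, F.lam_mul_star, mul_one]
    simp only [star_neg, neg_mul, mul_neg, neg_neg, e1, e2]
    exact (h.conj_right hb).symm

end Level

lemma rootT_flip' (F : FormRing R) {i j : Fin n ⊕ Fin n} {a : R} (h : i = j → star a ∈ F.Λ) :
    rootT F i j a = rootT F j i (-F.tw a) := by
  by_cases e : i = j
  · rw [F.tw_eq_neg (h e), neg_neg, e]
  · exact rootT_flip F e a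

lemma star_neg_tw_mem (F : FormRing R) {a : R} (h : star a ∈ F.Λ) : star (-F.tw a) ∈ F.Λ := by
  rwa [F.tw_eq_neg h, neg_neg]

namespace Level

variable {F : FormRing R} {V : Level F} {w : Fin n ⊕ Fin n → ℤ} {i j k l : Fin n ⊕ Fin n} {a b : R}

lemma long_mem {P Q : Prop} (hab : V.Mul P Q a b) (hP : P) (i : Fin n ⊕ Fin n) :
    -(star (F.nu i * b) * a * (F.nu i * b)) ∈ V.L := by
  have : star (F.nu i * b) * a * (F.nu i * b) = star b * a * b := by
    have e : a * (F.nu i * b) = F.nu i * (a * b) := by rw [← mul_assoc, ← F.nu_comm, mul_assoc]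
    rw [star_mul, mul_assoc, mul_assoc, e, ← mul_assoc (star (F.nu i)), F.star_nu_mul, one_mul,
      mul_assoc]
  rw [this]
  exact neg_mem (hab.conj_left hP).1

lemma mul_nu_mul_mem {P Q : Prop} (hab : V.Mul P Q a b) (i : Fin n ⊕ Fin n) : a * F.nu i * b ∈ V.M := by
  rw [← F.nu_comm, mul_assoc]
  exact nu_mul_mem hab.mul i

lemma commutator_long_mem {P Q : Prop} (hw : ∀ i, w i.swap = -w i) (hil : i ≠ l) (hl : l ≠ i.swap)
    (ha : star a ∈ F.Λ) (hab : V.Mul P Q a b) (hP : P)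
    (h2 : 0 ≤ w i.swap + w l) (h3 : 0 < w i + w l) :
    ⁅rootT F i i a, rootT F i.swap l b⁆ ∈ V.grp (fun i j => 0 < w i + w j) := by
  rw [hw] at h2
  rw [commutator_long F hil hl ha]
  refine mul_mem (rootT_mem_grp ⟨mul_nu_mul_mem hab i, fun e => absurd e hil⟩ fun _ => h3)
    (rootT_mem_grp ⟨V.le (long_mem hab hP i), fun _ => long_mem hab hP i⟩ fun _ => ?_)
  omega

/-- The weights of the factors in the commutator formula are positive combinations of the two given
weights. Nonnegative weights with positive sum thus produce only positive weights. -/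
lemma commutator_mem_of_eq (hw : ∀ i, w i.swap = -w i) (hp : j ≠ i.swap) (hq : l ≠ j)
    (ha : i = j → star a ∈ F.Λ) (hb : j.swap = l → star b ∈ F.Λ)
    (hab : V.Mul (i = j) (j.swap = l) a b)
    (h1 : 0 ≤ w i + w j) (h2 : 0 ≤ w j.swap + w l) (h3 : 0 < w i + w j + (w j.swap + w l)) :
    ⁅rootT F i j a, rootT F j.swap l b⁆ ∈ V.grp (fun i j => 0 < w i + w j) := by
  -- With `l = ρ(i)` the two roots would be opposite and their weights would add up to zero.
  have hil : l ≠ i.swap := by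
    rintro rfl
    have e1 := hw i
    have e2 := hw j
    omega
  have e2 := hw j
  by_cases hij : i = j
  · subst hij
    exact commutator_long_mem hw hq.symm hil (ha rfl) hab rfl h2 (by omega)
  -- Here the second root is long. Inverting the commutator and flipping the first root moves the
  -- long root to the front.
  by_cases hjl : l = j.swap
  · subst hjl
    rw [rootT_flip F hij, ← commutatorElement_inv]
    refine inv_mem ?_
    have := commutator_long_mem (V := V) (a := b) (b := -F.tw a) (i := j.swap) (l := i) hw
      (fun e => hp (by rw [← e, Sum.swap_swap])) (by rwa [Sum.swap_swap]) (hb rfl)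
      (hab.flip id ha).symm rfl
      (by rw [Sum.swap_swap]; omega) (by omega)
    rwa [Sum.swap_swap] at this
  by_cases hli : i = l
  · subst hli
    rw [commutator_short_short F hij hp]
    have := V.sub_tw_mem _ (mul_nu_mul_mem hab j)
    exact rootT_mem_grp ⟨V.le this, fun _ => this⟩ fun _ => by omega
  · rw [commutator_short F hij hp hli hil hq hjl]
    exact rootT_mem_grp ⟨mul_nu_mul_mem hab j, fun e => absurd e hli⟩ fun _ => by omega

/-- If neither `k` nor `l` is `ρ(i)` or `ρ(j)`, the root elements commute. Otherwise flipping one or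
both of them makes the adjacent indices match as in `commutator_mem_of_eq`. -/
lemma commutator_mem (hw : ∀ i, w i.swap = -w i) (hp : j ≠ i.swap) (hq : l ≠ k.swap)
    (ha : i = j → star a ∈ F.Λ) (hb : k = l → star b ∈ F.Λ)
    (hab : V.Mul (i = j) (k = l) a b)
    (h1 : 0 ≤ w i + w j) (h2 : 0 ≤ w k + w l) (h3 : 0 < w i + w j + (w k + w l)) :
    ⁅rootT F i j a, rootT F k l b⁆ ∈ V.grp (fun i j => 0 < w i + w j) := by
  have hp' : i ≠ j.swap := fun e => hp (by rw [e, Sum.swap_swap])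
  have hq' : k ≠ l.swap := fun e => hq (by rw [e, Sum.swap_swap])
  by_cases e1 : k = j.swap
  · subst e1
    rw [Sum.swap_swap] at hq
    exact commutator_mem_of_eq hw hp hq ha hb hab h1 h2 h3
  by_cases e2 : k = i.swap
  · subst e2
    rw [Sum.swap_swap] at hq
    rw [rootT_flip' F ha]
    exact commutator_mem_of_eq hw hp' hq (fun e => star_neg_tw_mem F (ha e.symm)) hb
      (hab.flip Eq.symm ha)
      (by omega) h2 (by omega)
  by_cases e3 : l = j.swap
  · subst e3
    rw [Sum.swap_swap] at hq'
    rw [rootT_flip' F hb]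
    exact commutator_mem_of_eq hw hp hq' ha (fun e => star_neg_tw_mem F (hb e.symm))
      (hab.symm.flip Eq.symm hb).symm h1 (by omega) (by omega)
  by_cases e4 : l = i.swap
  · subst e4
    rw [Sum.swap_swap] at hq'
    rw [rootT_flip' F ha, rootT_flip' F hb]
    exact commutator_mem_of_eq hw hp' hq' (fun e => star_neg_tw_mem F (ha e.symm))
      (fun e => star_neg_tw_mem F (hb e.symm)) 
      ((hab.flip Eq.symm ha).symm.flip Eq.symm hb).symm
      (by omega) (by omega) (by omega)
  rw [commutator_eq_one F hp hq e2 e1 e4 e3]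
  exact one_mem _

end Level

/-- The coordinate function of the index `x`. -/
def wt (x y : Fin n ⊕ Fin n) : ℤ := if y = x then 1 else if y = x.swap then -1 else 0

lemma wt_swap (x y : Fin n ⊕ Fin n) : wt x y.swap = -wt x y := by
  unfold wt
  have := swap_ne_self x
  by_cases h1 : y = x
  · subst h1; simp [this]
  by_cases h2 : y = x.swap
  · subst h2; simp [this]
  have h3 : y.swap ≠ x := fun e => h2 (swap_eq_iff.1 e)
  have h4 : y.swap ≠ x.swap := fun e => h1 (Sum.swap_leftInverse.injective e)
  simp [h1, h2, h3, h4]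

/-- Two roots that are not opposite lie in a common closed half space, and the second strictly
inside. If they are moreover different, the first can be put on the wall. The functional is a single
coordinate if `k` or `l` has a coordinate absent from `i, j`. Otherwise it is the sum or, up to
sign, the difference of the coordinates of `i` and `j`. -/
lemma exists_weight {i j k l : Fin n ⊕ Fin n} (hp : j ≠ i.swap) (hq : l ≠ k.swap)
    (h1 : ¬ (k = i.swap ∧ l = j.swap)) (h2 : ¬ (k = j.swap ∧ l = i.swap)) :
    ∃ w : Fin n ⊕ Fin n → ℤ, (∀ i, w i.swap = -w i) ∧ 0 ≤ w i + w j ∧ 0 < w k + w l ∧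
      (¬ (k = i ∧ l = j) → ¬ (k = j ∧ l = i) → w i + w j = 0) := by
  have hp' : i ≠ j.swap := fun e => hp (by rw [e, Sum.swap_swap])
  have hq' : k ≠ l.swap := fun e => hq (by rw [e, Sum.swap_swap])
  have key : ∀ x : Fin n ⊕ Fin n, x = k ∨ x = l → 
      ¬ (i = x ∨ i = x.swap ∨ j = x ∨ j = x.swap) → 0 < wt x k + wt x l ∧ wt x i + wt x j = 0 := by
    intro x hx h
    push Not at h
    obtain ⟨g1, g2, g3, g4⟩ := h
    constructor
    · rcases hx with rfl | rfl
      · simp only [wt, hq, if_true, if_false]; split_ifs <;> norm_num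
      · simp only [wt, hq', if_true, if_false]; split_ifs <;> norm_num
    · simp [wt, g1, g2, g3, g4]
  by_cases hk : i = k ∨ i = k.swap ∨ j = k ∨ j = k.swap
  swap
  · obtain ⟨g1, g2⟩ := key k (Or.inl rfl) hk
    exact ⟨wt k, wt_swap k, g2.ge, g1, fun _ _ => g2⟩
  by_cases hl : i = l ∨ i = l.swap ∨ j = l ∨ j = l.swap
  swap
  · obtain ⟨g1, g2⟩ := key l (Or.inr rfl) hl
    exact ⟨wt l, wt_swap l, g2.ge, g1, fun _ _ => g2⟩
  by_cases he : (k = i ∧ l = j) ∨ (k = j ∧ l = i)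
  · have hs : 0 < wt i i + wt j i + (wt i j + wt j j) := by
      simp only [wt, hp, hp', if_true, if_false]; split_ifs <;> norm_num
    refine ⟨fun x => wt i x + wt j x, fun x => by simp only [wt_swap]; ring, hs.le, ?_, by tauto⟩
    rcases he with ⟨rfl, rfl⟩ | ⟨rfl, rfl⟩
    · exact hs
    · simp only; linarith
  · push Not at he
    -- Both `k` and `l` are now among `±i, ±j`. Of the roots on these coordinates only `±(e_i +
    -- e_j)` are annihilated by the difference, and both are excluded; this also rules out `i = j`.
    have hne : wt i k - wt j k + (wt i l - wt j l) ≠ 0 := by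
      have s1 := swap_ne_self i
      have s2 := swap_ne_self j
      have s3 : i.swap.swap = i := Sum.swap_swap i
      have s4 : j.swap.swap = j := Sum.swap_swap j
      have s5 : k.swap.swap = k := Sum.swap_swap k
      have s6 : l.swap.swap = l := Sum.swap_swap l
      unfold wt
      grind
    have hz : wt i i - wt j i + (wt i j - wt j j) = 0 := by
      have hs : wt i j = wt j i := by
        simp only [wt, hp, hp', if_false, eq_comm]
      rw [hs]; simp [wt]
    rcases lt_or_gt_of_ne hne with h | h
    · exact ⟨fun x => -(wt i x - wt j x), fun x => by simp only [wt_swap]; ring,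
        by simp only; linarith, by simp only; linarith, fun _ _ => by linarith⟩
    · exact ⟨fun x => wt i x - wt j x, fun x => by simp only [wt_swap]; ring,
        hz.ge, h, fun _ _ => hz⟩

end Levels

/-! ### The relative elementary group is normalized by the absolute one -/

section Normality

variable {R : Type*} [Ring R] [StarRing R] {n : ℕ}

namespace Level

variable {F : FormRing R} {V W : Level F} {i j k l : Fin n ⊕ Fin n}

lemma grp_le {Φ : (Fin n ⊕ Fin n) → (Fin n ⊕ Fin n) → Prop} {H : Subgroup (GL (Fin n ⊕ Fin n) R)}
    (h : ∀ i j a, j ≠ i.swap → V.Adm i j a → Φ i j → rootT F i j a ∈ H) : V.grp Φ ≤ H := by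
  refine (Subgroup.closure_le _).2 ?_
  rintro _ ⟨i, j, a, h1, h2, h3, rfl⟩
  exact h i j a h1 h2 h3

lemma grp_normalizes {Φ : (Fin n ⊕ Fin n) → (Fin n ⊕ Fin n) → Prop}
    {H : Subgroup (GL (Fin n ⊕ Fin n) R)}
    (h : ∀ i j a, j ≠ i.swap → V.Adm i j a → Φ i j →
      ∀ g ∈ H, rootT F i j a * g * (rootT F i j a)⁻¹ ∈ H) :
    ∀ k ∈ V.grp Φ, ∀ g ∈ H, k * g * k⁻¹ ∈ H := by
  have : V.grp Φ ≤ Subgroup.normalizer (H : Set (GL (Fin n ⊕ Fin n) R)) := by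
    refine grp_le fun i j a h1 h2 h3 => Subgroup.mem_normalizer_iff.2 fun g => ⟨h i j a h1 h2 h3 g,
      fun hg => ?_⟩
    have := h i j (-a) h1 h2.neg h3 _ hg
    rw [rootT_neg] at this
    simpa [mul_assoc] using this
  exact fun k hk g hg => (Subgroup.mem_normalizer_iff.1 (this hk) g).1 hg

lemma mul_mul_inv_eq {G : Type*} [Group G] (g h : G) : g * h * g⁻¹ = ⁅g, h⁆ * h := by
  rw [commutatorElement_def, inv_mul_cancel_right]

/-- Root elements of nonnegative weight normalize the groups of positive weight. -/
lemma conj_grp_pos {w : Fin n ⊕ Fin n → ℤ} (hw : ∀ i, w i.swap = -w i) (hq : l ≠ k.swap) {x : R}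
    (hx : k = l → star x ∈ F.Λ) (hwq : 0 ≤ w k + w l) (hM : V.M ≤ W.M) (hL : V.L ≤ W.L)
    (hV : ∀ i j a, V.Adm (n := n) i j a → W.Mul (k = l) (i = j) x a) :
    V.grp (fun i j => 0 < w i + w j) ≤
      (W.grp (fun i j => 0 < w i + w j)).comap (MulAut.conj (rootT F k l x)).toMonoidHom := by
  refine grp_le fun i j a hp ha hwp => ?_
  change rootT F k l x * rootT F i j a * (rootT F k l x)⁻¹ ∈ W.grp _
  rw [mul_mul_inv_eq]
  exact mul_mem (commutator_mem hw hq hp hx (fun e => V.star_mem_Λ _ (ha.2 e)) (hV _ _ a ha) hwq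
    hwp.le (by omega)) (rootT_mem_grp ⟨hM ha.1, fun e => hL (ha.2 e)⟩ fun _ => hwp)

/-- Root elements of positive weight normalize the groups of nonnegative weight. -/
lemma conj_grp_nonneg {w : Fin n ⊕ Fin n → ℤ} (hw : ∀ i, w i.swap = -w i) (hq : l ≠ k.swap) {x : R}
    (hx : k = l → star x ∈ F.Λ) (hwq : 0 < w k + w l) (hM : V.M ≤ W.M) (hL : V.L ≤ W.L)
    (hV : ∀ i j a, V.Adm (n := n) i j a → W.Mul (k = l) (i = j) x a) :
    V.grp (fun i j => 0 ≤ w i + w j) ≤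
      (W.grp (fun i j => 0 ≤ w i + w j)).comap (MulAut.conj (rootT F k l x)).toMonoidHom := by
  refine grp_le fun i j a hp ha hwp => ?_
  change rootT F k l x * rootT F i j a * (rootT F k l x)⁻¹ ∈ W.grp _
  rw [mul_mul_inv_eq]
  exact mul_mem (grp_mono le_rfl le_rfl (fun i j h => h.le) (commutator_mem hw hq hp hx
    (fun e => V.star_mem_Λ _ (ha.2 e)) (hV _ _ a ha) hwq.le hwp (by omega)))
    (rootT_mem_grp ⟨hM ha.1, fun e => hL (ha.2 e)⟩ fun _ => hwp)

/-- The conjugate of a root element by a root element at a root that is not opposite. -/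
lemma conj_mem (hp : j ≠ i.swap) (hq : l ≠ k.swap)
    (h1 : ¬ (k = i.swap ∧ l = j.swap)) (h2 : ¬ (k = j.swap ∧ l = i.swap)) {a x : R}
    (hx : k = l → star x ∈ F.Λ) (hM : V.M ≤ W.M) (hL : V.L ≤ W.L) (ha : V.Adm i j a)
    (hV : ∀ i j a, V.Adm (n := n) i j a → W.Mul (k = l) (i = j) x a) :
    rootT F k l x * rootT F i j a * (rootT F k l x)⁻¹ ∈ W.grp (fun _ _ => True) := by
  obtain ⟨w, hw, h3, h4, -⟩ := exists_weight hp hq h1 h2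
  exact grp_mono le_rfl le_rfl (fun _ _ _ => trivial)
    (conj_grp_nonneg hw hq hx h4 hM hL hV (rootT_mem_grp ha fun _ => h3))

variable (F) in
/-- The level of all elements. -/
def top : Level F where
  M := ⊤
  L := F.Λ.comap (starAddEquiv : R ≃+ R).toAddMonoidHom
  le := le_top
  star_mem_Λ _ h := h
  lam_mul_mem _ _ := trivial
  star_mem _ _ := trivial
  sub_tw_mem a _ := by
    change star (a - F.tw a) ∈ F.Λ
    rw [star_sub, FormRing.tw, star_mul, star_star, star_star, ← F.lam_comm]
    simpa using F.min_mem (star a)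

variable (F) in
/-- The level of a two-sided ideal. -/
def ofIdeal (J : TwoSidedIdeal R) (hJ : ∀ a ∈ J, star a ∈ J) : Level F where
  M := J.asIdeal.toAddSubgroup
  L := J.asIdeal.toAddSubgroup ⊓ (top F).L
  le := inf_le_left
  star_mem_Λ _ h := h.2
  lam_mul_mem _ h := J.mul_mem_left _ _ h
  star_mem a h := hJ a h
  sub_tw_mem a h := ⟨J.sub_mem h (J.mul_mem_left _ _ (hJ a h)), (top F).sub_tw_mem a trivial⟩

lemma star_conj_mem {a : R} (b : R) (h : star a ∈ F.Λ) : star (star b * a * b) ∈ F.Λ := by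
  simpa [mul_assoc] using F.conj_mem b _ h

lemma conj_star_mem {a : R} (b : R) (h : star a ∈ F.Λ) : star (b * a * star b) ∈ F.Λ := by
  simpa [mul_assoc] using F.conj_mem (star b) _ h

lemma top_mul {P Q : Prop} {a b : R} (ha : P → star a ∈ F.Λ) (hb : Q → star b ∈ F.Λ) :
    (top F).Mul P Q a b where
  mul := trivial
  mul_rev := trivial
  mulStar := trivial
  starMul := trivial
  conj_left h := ⟨star_conj_mem b (ha h), conj_star_mem b (ha h)⟩
  conj_right h := ⟨star_conj_mem a (hb h), conj_star_mem a (hb h)⟩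

variable {J : TwoSidedIdeal R} {hJ : ∀ a ∈ J, star a ∈ J}

lemma ofIdeal_mul {P : Prop} {a b : R} (hb : P → star b ∈ F.Λ)
    (ha : (ofIdeal F J hJ).Adm i j a) : (ofIdeal F J hJ).Mul P (i = j) b a where
  mul := J.mul_mem_left _ _ ha.1
  mul_rev := J.mul_mem_right _ _ ha.1
  mulStar := J.mul_mem_left _ _ (hJ a ha.1)
  starMul := J.mul_mem_left _ _ ha.1
  conj_left h := ⟨⟨J.mul_mem_left _ _ ha.1, star_conj_mem a (hb h)⟩,
    ⟨J.mul_mem_right _ _ (J.mul_mem_right _ _ ha.1), conj_star_mem a (hb h)⟩⟩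
  conj_right h := ⟨⟨J.mul_mem_right _ _ (J.mul_mem_left _ _ ha.1), star_conj_mem b (ha.2 h).2⟩,
    ⟨J.mul_mem_right _ _ (J.mul_mem_left _ _ ha.1), conj_star_mem b (ha.2 h).2⟩⟩

lemma exists_wt_eq_zero (hn : 3 ≤ n) (i j : Fin n ⊕ Fin n) :
    ∃ h : Fin n ⊕ Fin n, i ≠ h ∧ i ≠ h.swap ∧ j ≠ h ∧ j ≠ h.swap := by
  let e : Fin n ⊕ Fin n → Fin n := Sum.elim id id
  -- As `n ≥ 3`, some coordinate is used by neither `i` nor `j`.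
  obtain ⟨m, hm⟩ : ∃ m : Fin n, m ∉ ({e i, e j} : Finset (Fin n)) := by
    by_contra! h
    have h1 := Finset.card_le_card (fun x _ => h x : (Finset.univ : Finset (Fin n)) ⊆ _)
    have h2 : ({e i, e j} : Finset (Fin n)).card ≤ 2 := Finset.card_le_two
    rw [Finset.card_univ, Fintype.card_fin] at h1
    omega
  simp only [Finset.mem_insert, Finset.mem_singleton, not_or] at hm
  refine ⟨Sum.inl m, ?_, ?_, ?_, ?_⟩
  · rintro rfl; exact hm.1 rfl
  · rintro rfl; exact hm.1 rfl
  · rintro rfl; exact hm.2 rfl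
  · rintro rfl; exact hm.2 rfl

/-- A root element is expressed by root elements whose roots are not proportional to the given
one. -/
lemma exists_decomp (hn : 3 ≤ n) (hp : j ≠ i.swap) {c : R}
    (hc : i ≠ j → ∃ a ∈ V.M, ∃ b ∈ W.M, c = a * b)
    (hc' : i = j → ∃ a ∈ V.L, ∃ b ∈ W.M, a * b ∈ V.M ∧ c = -(star b * a * b)) :
    ∃ h : Fin n ⊕ Fin n, wt h i = 0 ∧ wt h j = 0 ∧ ∃ A B K : GL (Fin n ⊕ Fin n) R,
      A ∈ V.grp (fun i j => 0 < wt h i + wt h j) ∧ B ∈ V.grp (fun i j => 0 < wt h i + wt h j) ∧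
      K ∈ W.grp (fun i j => 0 < wt h.swap i + wt h.swap j) ∧ rootT F i j c = B * ⁅A, K⁆ := by
  obtain ⟨h, h1, h2, h3, h4⟩ := exists_wt_eq_zero hn i j
  have w1 : wt h i = 0 := by simp [wt, h1, h2]
  have w2 : wt h j = 0 := by simp [wt, h3, h4]
  have w3 : wt h h = 1 := by simp [wt]
  have w4 : wt h.swap h.swap = 1 := by simp [wt]
  have w5 : wt h.swap j = 0 := by simp [wt, h3, h4]
  refine ⟨h, w1, w2, ?_⟩
  -- A long root element is the second factor of `[2e_h, -e_h + e_i]`, and `B` cancels the short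
  -- first factor. A short one is the commutator of `e_i + e_h` and `-e_h + e_j`, with `B = 1`.
  by_cases hij : i = j
  · subst hij
    obtain ⟨a, ha, b, hb, hab, rfl⟩ := hc' rfl
    refine ⟨rootT F h h a, (rootT F h i (a * b))⁻¹, rootT F h.swap i (star (F.nu h) * b),
      rootT_mem_grp ⟨V.le ha, fun _ => ha⟩ fun _ => by omega,
      inv_mem (rootT_mem_grp ⟨hab, fun e => absurd e.symm h1⟩ fun _ => by omega),
      rootT_mem_grp ⟨?_, fun e => absurd e.symm h2⟩ fun _ => by omega, ?_⟩
    · cases h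
      · simpa [FormRing.nu] using hb
      · exact star_lam_mul_mem hb
    · have e : F.nu h * (star (F.nu h) * b) = b := by
        rw [F.nu_comm, mul_assoc, ← F.nu_comm, ← mul_assoc, F.star_nu_mul, one_mul]
      rw [commutator_long F h1.symm h2 (V.star_mem_Λ _ ha), mul_assoc a, e, inv_mul_cancel_left]
  · obtain ⟨a, ha, b, hb, rfl⟩ := hc hij
    refine ⟨rootT F i h (a * star (F.nu h)), 1, rootT F h.swap j b,
      rootT_mem_grp ⟨?_, fun e => absurd e h1⟩ fun _ => by omega, one_mem _,
      rootT_mem_grp ⟨hb, fun e => absurd e.symm h4⟩ fun _ => by omega, ?_⟩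
    · rw [← F.star_nu_comm]
      cases h
      · simpa [FormRing.nu] using ha
      · exact star_lam_mul_mem ha
    · rw [commutator_short F h1 (fun e => h2 (swap_eq_iff.1 e.symm)) hij hp h3 h4, one_mul,
        mul_assoc a, F.star_nu_mul, mul_one]

end Level

section

variable {F : FormRing R} {J : TwoSidedIdeal R} {hJ : ∀ a ∈ J, star a ∈ J}
  {i j k l : Fin n ⊕ Fin n}

variable (F J hJ) in
/-- The group generated by the conjugates of the root elements of level `J` by opposite root
elements at roots in `Φ`. -/
def conjGrp (Φ : (Fin n ⊕ Fin n) → (Fin n ⊕ Fin n) → Prop) : Subgroup (GL (Fin n ⊕ Fin n) R) :=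
  Subgroup.closure {g | ∃ i j x a, j ≠ i.swap ∧ (Level.top F).Adm i j x ∧
    (Level.ofIdeal F J hJ).Adm i j a ∧ (x ≠ 0 → Φ i.swap j.swap) ∧
    g = rootT F i.swap j.swap x * rootT F i j a * (rootT F i.swap j.swap x)⁻¹}

/-- The trivial conjugator `x = 0` is exempt from `Φ` in `conjGrp`, so root elements of level `J`
belong to it for every `Φ`. -/
lemma grp_le_conjGrp {Ψ Φ : (Fin n ⊕ Fin n) → (Fin n ⊕ Fin n) → Prop} :
    (Level.ofIdeal F J hJ).grp Ψ ≤ conjGrp F J hJ Φ := by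
  refine Level.grp_le fun i j a hp ha _ => Subgroup.subset_closure
    ⟨i, j, 0, a, hp, ⟨zero_mem _, fun _ => zero_mem _⟩, ha, fun h => absurd rfl h, ?_⟩
  simp [rootT_zero]

lemma adm_top_neg_tw {x : R} (hx : (Level.top F).Adm i j x) :
    (Level.top F).Adm j i (-F.tw x) :=
  ⟨trivial, fun e => star_neg_tw_mem F (hx.2 e.symm)⟩

lemma adm_ofIdeal_neg_tw {x : R} (hx : (Level.ofIdeal F J hJ).Adm i j x) :
    (Level.ofIdeal F J hJ).Adm j i (-F.tw x) :=
  ⟨neg_mem (Level.tw_mem hx.1), fun e =>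
    ⟨J.neg_mem (Level.tw_mem hx.1), star_neg_tw_mem F (hx.2 e.symm).2⟩⟩

/-- At the opposite root the conjugate is by definition a generator of `conjGrp`. At any other root
it is still a product of root elements of level `J`. -/
lemma conj_grp_le_conjGrp {Φ : (Fin n ⊕ Fin n) → (Fin n ⊕ Fin n) → Prop}
    (hq : l ≠ k.swap) (hΦ : Φ k l) {x : R} (hx : (Level.top F).Adm k l x) :
    (Level.ofIdeal F J hJ).grp (fun _ _ => True) ≤
      (conjGrp F J hJ Φ).comap (MulAut.conj (rootT F k l x)).toMonoidHom := by
  refine Level.grp_le fun i j a hp ha _ => ?_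
  change rootT F k l x * rootT F i j a * (rootT F k l x)⁻¹ ∈ conjGrp F J hJ Φ
  by_cases h1 : k = i.swap ∧ l = j.swap
  · obtain ⟨rfl, rfl⟩ := h1
    refine Subgroup.subset_closure ⟨i, j, x, a, hp, ⟨hx.1, fun e => hx.2 (by rw [e])⟩, ha,
      fun _ => hΦ, rfl⟩
  by_cases h2 : k = j.swap ∧ l = i.swap
  · obtain ⟨rfl, rfl⟩ := h2
    rw [rootT_flip' F (i := i) fun e => (ha.2 e).2]
    exact Subgroup.subset_closure ⟨j, i, x, _, fun e => hp (by rw [e, Sum.swap_swap]),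
      ⟨hx.1, fun e => hx.2 (by rw [e])⟩, adm_ofIdeal_neg_tw ha, fun _ => hΦ, rfl⟩
  exact grp_le_conjGrp (Level.conj_mem hp hq h1 h2 hx.2 le_rfl le_rfl ha
    fun _ _ _ hb => Level.ofIdeal_mul hx.2 hb)

/-- Conjugating a generator of `conjGrp` by a root element at a root that is not proportional. -/
lemma conj_generator_mem {Φ : (Fin n ⊕ Fin n) → (Fin n ⊕ Fin n) → Prop} (hp : j ≠ i.swap)
    (hq : l ≠ k.swap)
    (h1 : ¬ (k = i.swap ∧ l = j.swap)) (h2 : ¬ (k = j.swap ∧ l = i.swap))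
    (h3 : ¬ (k = i ∧ l = j)) (h4 : ¬ (k = j ∧ l = i)) {x y a : R}
    (hx : (Level.top F).Adm i j x) (hy : (Level.top F).Adm k l y)
    (ha : (Level.ofIdeal F J hJ).Adm i j a) (hΦ : Φ i.swap j.swap) :
    rootT F k l y * (rootT F i.swap j.swap x * rootT F i j a * (rootT F i.swap j.swap x)⁻¹) *
      (rootT F k l y)⁻¹ ∈ conjGrp F J hJ Φ := by
  -- The weight vanishes on the root of `a` and on its opposite, and is positive on that of `y`.
  -- With `p` the opposite root element, the conjugate equals `p (p⁻¹ y p) a (p⁻¹ y p)⁻¹ p⁻¹`. Here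
  -- `p⁻¹ y p` is a product of elements of positive weight, which normalizes the level `J` group of
  -- nonnegative weight.
  obtain ⟨w, hw, -, h5, h6⟩ := exists_weight hp hq h1 h2
  replace h6 := h6 h3 h4
  have hp' : j.swap ≠ i.swap.swap := fun e => hp (Sum.swap_leftInverse.injective e)
  have hi := hw i
  have hj := hw j
  have hx' : (Level.top F).Adm i.swap j.swap x :=
    ⟨hx.1, fun e => hx.2 (Sum.swap_leftInverse.injective e)⟩
  set p := rootT F i.swap j.swap x with hpdef
  have hg : p⁻¹ * rootT F k l y * p ∈ (Level.top F).grp (fun i j => 0 < w i + w j) := by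
    have := Level.conj_grp_pos (V := Level.top F) (W := Level.top F) (x := -x) hw hp' hx'.neg.2
      (by omega) le_rfl le_rfl (fun _ _ _ ha => Level.top_mul hx'.neg.2 ha.2)
      (Level.rootT_mem_grp (i := k) (j := l) hy fun _ => h5)
    rw [rootT_neg, Subgroup.mem_comap] at this
    simpa using this
  have hn : ∀ g ∈ (Level.top F).grp (fun i j => 0 < w i + w j),
      (∀ h ∈ (Level.ofIdeal F J hJ).grp (fun i j => 0 ≤ w i + w j),
        g * h * g⁻¹ ∈ (Level.ofIdeal F J hJ).grp (fun i j => 0 ≤ w i + w j)) := by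
    exact Level.grp_normalizes fun i j b g1 g2 g3 h hh => Level.conj_grp_nonneg hw g1 g2.2 g3
      le_rfl le_rfl (fun _ _ _ ha => Level.ofIdeal_mul g2.2 ha) hh
  have := hn _ hg _ (Level.rootT_mem_grp ha fun _ => h6.ge)
  have := conj_grp_le_conjGrp hp' hΦ hx' (Level.grp_mono le_rfl le_rfl (fun _ _ _ => trivial) this)
  rw [Subgroup.mem_comap] at this
  convert this using 1
  simp only [MulEquiv.coe_toMonoidHom, MulAut.conj_apply]
  rw [← hpdef]
  group

/-- If a root element conjugates the generators at the opposite root into the group, then it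
conjugates all of the group into itself. -/
lemma conj_conjGrp {Φ : (Fin n ⊕ Fin n) → (Fin n ⊕ Fin n) → Prop} (hs : ∀ i j, Φ i j → Φ j i)
    (hq : l ≠ k.swap) (hΦ : Φ k l) {y : R} (hy : (Level.top F).Adm k l y)
    (hopp : Φ k.swap l.swap → ∀ i j y x a, j ≠ i.swap → (Level.top F).Adm i j y →
      (Level.top F).Adm i j x → (Level.ofIdeal F J hJ).Adm i j a →
      rootT F i j y * (rootT F i.swap j.swap x * rootT F i j a * (rootT F i.swap j.swap x)⁻¹) *
        (rootT F i j y)⁻¹ ∈ conjGrp F J hJ Φ) :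
    ∀ g ∈ conjGrp F J hJ Φ, rootT F k l y * g * (rootT F k l y)⁻¹ ∈ conjGrp F J hJ Φ := by
  have : conjGrp F J hJ Φ ≤
      (conjGrp F J hJ Φ).comap (MulAut.conj (rootT F k l y)).toMonoidHom := by
    refine (Subgroup.closure_le _).2 ?_
    rintro _ ⟨i, j, x, a, hp, hx, ha, hxΦ, rfl⟩
    change rootT F k l y * _ * (rootT F k l y)⁻¹ ∈ conjGrp F J hJ Φ
    by_cases hx0 : x = 0
    · subst hx0
      rw [rootT_zero, one_mul, inv_one, mul_one]
      exact conj_grp_le_conjGrp hq hΦ hy (Level.rootT_mem_grp ha fun _ => trivial)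
    specialize hxΦ hx0
    -- At the root of the conjugator the two arguments simply add.
    have merge : ∀ y, (Level.top F).Adm i.swap j.swap y → rootT F i.swap j.swap y *
        (rootT F i.swap j.swap x * rootT F i j a * (rootT F i.swap j.swap x)⁻¹) *
          (rootT F i.swap j.swap y)⁻¹ ∈ conjGrp F J hJ Φ := by
      intro y hy
      refine Subgroup.subset_closure ⟨i, j, y + x, a, hp, ⟨trivial, fun e => add_mem (hy.2 ?_)
        (hx.2 e)⟩, ha, fun _ => hxΦ, ?_⟩
      · rw [e]
      · rw [rootT_add]; group
    by_cases h1 : k = i.swap ∧ l = j.swap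
    · obtain ⟨rfl, rfl⟩ := h1
      exact merge y hy
    by_cases h2 : k = j.swap ∧ l = i.swap
    · obtain ⟨rfl, rfl⟩ := h2
      rw [rootT_flip' F (i := j.swap) hy.2]
      exact merge _ (adm_top_neg_tw hy)
    by_cases h3 : k = i ∧ l = j
    · obtain ⟨rfl, rfl⟩ := h3
      exact hopp hxΦ _ _ _ _ _ hp hy hx ha
    by_cases h4 : k = j ∧ l = i
    · obtain ⟨rfl, rfl⟩ := h4
      rw [rootT_flip' F (i := k) hy.2]
      exact hopp (hs _ _ hxΦ) _ _ _ _ _ hp (adm_top_neg_tw hy) hx ha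
    exact conj_generator_mem hp hq h1 h2 h3 h4 hx hy ha hxΦ
  exact this

lemma conjGrp_mono {Φ Ψ : (Fin n ⊕ Fin n) → (Fin n ⊕ Fin n) → Prop} (h : ∀ i j, Φ i j → Ψ i j) :
    conjGrp F J hJ Φ ≤ conjGrp F J hJ Ψ := by
  refine Subgroup.closure_mono ?_
  rintro _ ⟨i, j, x, a, h1, h2, h3, h4, rfl⟩
  exact ⟨i, j, x, a, h1, h2, h3, fun e => h _ _ (h4 e), rfl⟩

/-- Elements of positive weight conjugate the group of level `J` into `conjGrp`. -/
lemma conj_pos_mem {w : Fin n ⊕ Fin n → ℤ} (hw : ∀ i, w i.swap = -w i)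
    {g h : GL (Fin n ⊕ Fin n) R} (hg : g ∈ (Level.top F).grp (fun i j => 0 < w i + w j))
    (hh : h ∈ (Level.ofIdeal F J hJ).grp (fun _ _ => True)) :
    g * h * g⁻¹ ∈ conjGrp F J hJ (fun _ _ => True) := by
  refine conjGrp_mono (fun _ _ _ => trivial) (Level.grp_normalizes
    (H := conjGrp F J hJ (fun i j => 0 < w i + w j)) ?_ g hg h (grp_le_conjGrp hh))
  intro k l y hq hy hΦ
  -- For `Φ` given by positive weight, a root and its opposite cannot both satisfy `Φ`. The case of
  -- equal roots in `conj_conjGrp` is therefore vacuous.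
  refine conj_conjGrp (fun i j e => by rwa [add_comm]) hq hΦ hy fun e => ?_
  rw [hw, hw] at e
  omega

/-- Conjugating a generator of `conjGrp` by a root element at the same root. -/
lemma conj_same_mem (hn : 3 ≤ n) (hp : j ≠ i.swap) {x y a : R}
    (hy : (Level.top F).Adm i j y) (hx : (Level.top F).Adm i j x)
    (ha : (Level.ofIdeal F J hJ).Adm i j a) :
    rootT F i j y * (rootT F i.swap j.swap x * rootT F i j a * (rootT F i.swap j.swap x)⁻¹) *
      (rootT F i j y)⁻¹ ∈ conjGrp F J hJ (fun _ _ => True) := by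
  -- The coordinate `h` has weight zero on the root and its opposite, so conjugation by `y` and `x`
  -- preserves the groups of positive and of negative `h`-weight. Only `K` is not of level `J`, and
  -- its conjugate has one-signed weight, so `conj_pos_mem` applies.
  obtain ⟨h, w1, w2, A, B, K, hA, hB, hK, e⟩ := Level.exists_decomp (V := Level.ofIdeal F J hJ)
    (W := Level.top F) (c := a) hn hp (fun _ => ⟨a, ha.1, 1, trivial, by simp⟩)
    (fun e => ⟨-a, neg_mem (ha.2 e), 1, trivial, by simpa using neg_mem ha.1, by simp⟩)
  have hp' : j.swap ≠ i.swap.swap := fun e => hp (Sum.swap_leftInverse.injective e)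
  have hx' : (Level.top F).Adm i.swap j.swap x :=
    ⟨hx.1, fun e => hx.2 (Sum.swap_leftInverse.injective e)⟩
  have hws : ∀ x, wt h.swap x = -wt h x := fun x => by
    rw [← wt_swap]
    simp only [wt, Sum.swap_swap, ← swap_eq_iff (j := h)]
  have conjV : ∀ {V : Level F} {h : Fin n ⊕ Fin n} (_ : wt h i = 0) (_ : wt h j = 0)
      (_ : ∀ k l x, (Level.top F).Adm (n := n) k l x → ∀ i j a, V.Adm (n := n) i j a →
        V.Mul (k = l) (i = j) x a)
      {g} (_ : g ∈ V.grp (fun i j => 0 < wt h i + wt h j)),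
      (rootT F i j y * rootT F i.swap j.swap x) * g * (rootT F i j y * rootT F i.swap j.swap x)⁻¹
        ∈ V.grp (fun i j => 0 < wt h i + wt h j) := by
    intro V h w1 w2 hV g hg
    have h1 := Level.conj_grp_pos (wt_swap h) hp' hx'.2
      (by rw [wt_swap, wt_swap, w1, w2]; simp) le_rfl le_rfl (hV _ _ x hx') hg
    have h2 := Level.conj_grp_pos (wt_swap h) hp hy.2 (by rw [w1, w2]; simp) le_rfl le_rfl
      (hV _ _ y hy) h1
    simpa [mul_assoc] using h2
  have hA' := conjV w1 w2 (fun _ _ _ hx _ _ _ ha => Level.ofIdeal_mul hx.2 ha) hA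
  have hB' := conjV w1 w2 (fun _ _ _ hx _ _ _ ha => Level.ofIdeal_mul hx.2 ha) hB
  have hK' := conjV (h := h.swap) (by rw [hws, w1, neg_zero]) (by rw [hws, w2, neg_zero])
    (fun _ _ _ hx _ _ _ ha => Level.top_mul hx.2 ha.2) hK
  set g := rootT F i j y * rootT F i.swap j.swap x
  have e2 : rootT F i j y * (rootT F i.swap j.swap x * rootT F i j a *
      (rootT F i.swap j.swap x)⁻¹) * (rootT F i j y)⁻¹ =
      (g * B * g⁻¹) * ((g * A * g⁻¹) * ((g * K * g⁻¹) * (g * A * g⁻¹)⁻¹ * (g * K * g⁻¹)⁻¹)) := by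
    rw [e, commutatorElement_def]
    simp only [g]
    group
  rw [e2]
  exact mul_mem (grp_le_conjGrp hB') (mul_mem (grp_le_conjGrp hA')
    (conj_pos_mem (wt_swap h.swap) hK'
    (inv_mem (Level.grp_mono le_rfl le_rfl (fun _ _ _ => trivial) hA'))))

/-- The relative group is normalized by the absolute one. -/
theorem conjGrp_normal (hn : 3 ≤ n) {g h : GL (Fin n ⊕ Fin n) R}
    (hg : g ∈ (Level.top F).grp (fun _ _ => True))
    (hh : h ∈ conjGrp F J hJ (fun _ _ => True)) :
    g * h * g⁻¹ ∈ conjGrp F J hJ (fun _ _ => True) := by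
  refine Level.grp_normalizes ?_ g hg h hh
  intro k l y hq hy _
  exact conj_conjGrp (fun _ _ _ => trivial) hq trivial hy
    fun _ i j y x a hp hy hx ha => conj_same_mem hn hp hy hx ha

end

end Normality

/-! ### Functoriality, admissible scalars and substitutions -/

section Hom

variable {R S T : Type*} [Ring R] [StarRing R] [Ring S] [StarRing S] [Ring T] [StarRing T] {n : ℕ}

/-- Homomorphisms of form rings. -/
structure IsFormHom (F : FormRing R) (G : FormRing S) (f : R →+* S) : Prop where
  map_star : ∀ a, f (star a) = star (f a)
  map_lam : f F.lam = G.lam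
  map_mem : ∀ a ∈ F.Λ, f a ∈ G.Λ

lemma IsFormHom.comp {F : FormRing R} {G : FormRing S} {H : FormRing T} {g : S →+* T} {f : R →+* S}
    (hg : IsFormHom G H g) (hf : IsFormHom F G f) : IsFormHom F H (g.comp f) where
  map_star a := by simp [hf.map_star, hg.map_star]
  map_lam := by simp [hf.map_lam, hg.map_lam]
  map_mem a ha := hg.map_mem _ (hf.map_mem _ ha)

lemma IsFormHom.map_tw {F : FormRing R} {G : FormRing S} {f : R →+* S} (hf : IsFormHom F G f)
    (a : R) : f (F.tw a) = G.tw (f a) := by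
  rw [FormRing.tw, FormRing.tw, map_mul, hf.map_star, hf.map_star, hf.map_lam]

/-- The homomorphism of general linear groups induced by a homomorphism of rings. -/
def glMap (f : R →+* S) : GL (Fin n ⊕ Fin n) R →* GL (Fin n ⊕ Fin n) S :=
  Units.map f.mapMatrix.toMonoidHom

lemma glMap_val (f : R →+* S) (g : GL (Fin n ⊕ Fin n) R) : (glMap f g).val = g.val.map f := rfl

lemma glMap_glMap (g : S →+* T) (f : R →+* S) (x : GL (Fin n ⊕ Fin n) R) :
    glMap g (glMap f x) = glMap (g.comp f) x := rfl

lemma glMap_ext {f : R →+* S} {g : R →+* T} {x y : GL (Fin n ⊕ Fin n) R}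
    (h : ∀ a b, f a = f b → g a = g b → a = b) (hf : glMap f x = glMap f y)
    (hg : glMap g x = glMap g y) : x = y := by
  ext i j
  refine h _ _ ?_ ?_
  · have := congrArg (fun z : GL (Fin n ⊕ Fin n) S => z.val i j) hf
    exact this
  · have := congrArg (fun z : GL (Fin n ⊕ Fin n) T => z.val i j) hg
    exact this

lemma glMap_rootT {F : FormRing R} {G : FormRing S} {f : R →+* S} (hf : IsFormHom F G f)
    (i j : Fin n ⊕ Fin n) (a : R) : glMap f (rootT F i j a) = rootT G i j (f a) := by
  by_cases h : j = i.swap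
  · simp [rootT, h]
  have hnu : ∀ i : Fin n ⊕ Fin n, f (F.nu i) = G.nu i := by
    intro i
    cases i <;> simp [FormRing.nu, hf.map_lam]
  ext1
  rw [glMap_val, rootT_val F h, rootT_val G h, Matrix.map_add f (map_add f),
    Matrix.map_one f (map_zero f) (map_one f)]
  congr 1
  unfold rootN rootX
  split_ifs
  · rw [Matrix.map_single, map_mul, hnu]
  · rw [Matrix.map_sub f (map_sub f), Matrix.map_single, Matrix.map_single, map_mul, map_mul, hnu,
      hnu, hf.map_tw]

/-- The elementary group. -/
abbrev eqGrp (F : FormRing R) (n : ℕ) : Subgroup (GL (Fin n ⊕ Fin n) R) :=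
  (Level.top F).grp (fun _ _ => True)

lemma IsFormHom.star_mem {F : FormRing R} {G : FormRing S} {f : R →+* S} (hf : IsFormHom F G f)
    {a : R} (ha : star a ∈ F.Λ) : star (f a) ∈ G.Λ := by
  rw [← hf.map_star]
  exact hf.map_mem _ ha

lemma IsFormHom.map_eqGrp {F : FormRing R} {G : FormRing S} {f : R →+* S} (hf : IsFormHom F G f)
    {g : GL (Fin n ⊕ Fin n) R} (hg : g ∈ eqGrp F n) : glMap f g ∈ eqGrp G n := by
  have : eqGrp F n ≤ (eqGrp G n).comap (glMap f) := by
    refine Level.grp_le fun i j a _ ha _ => ?_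
    rw [Subgroup.mem_comap, glMap_rootT hf]
    exact Level.rootT_mem_grp ⟨trivial, fun e => hf.star_mem (ha.2 e)⟩ fun _ => trivial
  exact this hg

/-- The central symmetric elements that preserve the form parameter. -/
def FormRing.scalars (F : FormRing R) : Subring R where
  carrier := {x | x ∈ Subring.center R ∧ star x = x ∧ ∀ a ∈ F.Λ, x * a ∈ F.Λ}
  mul_mem' := by
    rintro x y ⟨h1, h2, h3⟩ ⟨h4, h5, h6⟩
    refine ⟨mul_mem h1 h4, ?_, fun a ha => ?_⟩
    · rw [star_mul, h2, h5, Subring.mem_center_iff.1 h1]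
    · rw [mul_assoc]
      exact h3 _ (h6 _ ha)
  one_mem' := ⟨one_mem _, star_one _, fun a ha => by rwa [one_mul]⟩
  add_mem' := by
    rintro x y ⟨h1, h2, h3⟩ ⟨h4, h5, h6⟩
    refine ⟨add_mem h1 h4, by rw [star_add, h2, h5], fun a ha => ?_⟩
    rw [add_mul]
    exact add_mem (h3 _ ha) (h6 _ ha)
  zero_mem' := ⟨zero_mem _, star_zero _, fun a ha => by rw [zero_mul]; exact zero_mem _⟩
  neg_mem' := by
    rintro x ⟨h1, h2, h3⟩
    refine ⟨neg_mem h1, by rw [star_neg, h2], fun a ha => ?_⟩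
    rw [neg_mul]
    exact neg_mem (h3 _ ha)

namespace FormRing

variable {F : FormRing R} {s : R}

lemma scalars_comm (hs : s ∈ F.scalars) (a : R) : s * a = a * s :=
  (Subring.mem_center_iff.1 hs.1 a).symm

lemma scalars_left_comm (hs : s ∈ F.scalars) (a b : R) : a * (s * b) = s * (a * b) := by
  rw [← mul_assoc, ← scalars_comm hs, mul_assoc]

lemma scalars_star_mul (hs : s ∈ F.scalars) (a : R) : star (s * a) = s * star a := by
  rw [star_mul, hs.2.1, scalars_comm hs]

lemma scalars_star_mem (hs : s ∈ F.scalars) {a : R} (ha : star a ∈ F.Λ) :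
    star (s * a) ∈ F.Λ := by
  rw [scalars_star_mul hs]
  exact hs.2.2 _ ha

lemma mem_poly_Λ {p : R[X]} : p ∈ F.poly.Λ ↔ ∀ k, p.coeff k ∈ F.Λ := Iff.rfl

lemma star_mem_poly_Λ {p : R[X]} : star p ∈ F.poly.Λ ↔ ∀ k, star (p.coeff k) ∈ F.Λ := by
  simp only [mem_poly_Λ, coeff_star]

lemma C_mem_scalars (hs : s ∈ F.scalars) : C s ∈ F.poly.scalars := by
  refine ⟨Subring.mem_center_iff.2 fun p => ?_, by rw [star_C, hs.2.1], fun p hp k => ?_⟩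
  · ext k
    rw [coeff_C_mul, coeff_mul_C, scalars_comm hs]
  · rw [coeff_C_mul]
    exact hs.2.2 _ (hp k)

lemma X_mem_scalars : X ∈ F.poly.scalars := by
  refine ⟨Subring.mem_center_iff.2 fun p => (X_mul (p := p)).symm, ?_, fun p hp k => ?_⟩
  · ext k
    rw [coeff_star, coeff_X]
    split_ifs <;> simp
  · cases k with
    | zero => simp [zero_mem]
    | succ k => rw [coeff_X_mul]; exact hp k

end FormRing

/-- The extension of `f` to `R[X]` with `X ↦ x`. -/
def evalAt {G : FormRing S} (f : R →+* S) (x : G.scalars) : R[X] →+* S :=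
  eval₂RingHom' f x.1 fun a => (FormRing.scalars_comm x.2 (f a)).symm

section

variable {G : FormRing S} (f : R →+* S) (x : G.scalars)

@[simp] lemma evalAt_C (a : R) : evalAt f x (C a) = f a := eval₂_C ..

@[simp] lemma evalAt_X : evalAt f x X = x := eval₂_X ..

lemma isFormHom_C (F : FormRing R) : IsFormHom F F.poly C where
  map_star a := (star_C a).symm
  map_lam := rfl
  map_mem a ha k := by
    rw [coeff_C]
    split_ifs
    exacts [ha, zero_mem _]

variable {f x} in
lemma isFormHom_evalAt {F : FormRing R} (hf : IsFormHom F G f) :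
    IsFormHom F.poly G (evalAt f x) where
  map_star p := by
    induction p using Polynomial.induction_on' with
    | add p q hp hq => simp [hp, hq]
    | monomial k a =>
      have hX : star (X : R[X]) = X := (FormRing.X_mem_scalars (F := F)).2.1
      rw [← C_mul_X_pow_eq_monomial, star_mul, star_pow, hX, star_C]
      simp only [map_mul, map_pow, evalAt_C, evalAt_X, star_mul, star_pow, hf.map_star, x.2.2.1]
  map_lam := (evalAt_C f x _).trans hf.map_lam
  map_mem p hp := by
    rw [← sum_C_mul_X_pow_eq p, Polynomial.sum, map_sum]
    refine sum_mem fun k _ => ?_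
    rw [map_mul, map_pow, evalAt_C, evalAt_X, ← FormRing.scalars_comm (pow_mem x.2 k)]
    exact (pow_mem x.2 k : (x : S) ^ k ∈ G.scalars).2.2 _ (hf.map_mem _ (hp k))

end

lemma isFormHom_map {F : FormRing R} {G : FormRing S} {f : R →+* S} (hf : IsFormHom F G f) :
    IsFormHom F.poly G.poly (mapRingHom f) where
  map_star p := by
    ext k
    simp only [coe_mapRingHom, coeff_map, coeff_star, hf.map_star]
  map_lam := by rw [coe_mapRingHom, FormRing.poly, map_C, hf.map_lam]; rfl
  map_mem p hp k := by
    rw [coe_mapRingHom, coeff_map]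
    exact hf.map_mem _ (hp k)

end Hom

/-! ### Clearing denominators in conjugations -/

section Localization

variable {R S : Type*} [Ring R] [StarRing R] [Ring S] [StarRing S] {n : ℕ}

/-- `φ` is a localization of form rings at the submonoid `M` of scalars. -/
structure IsFormLoc (F : FormRing R) (G : FormRing S) (M : Submonoid R) (φ : R →+* S) : Prop
    extends IsFormHom F G φ where
  le : ∀ s ∈ M, s ∈ F.scalars
  map_le : ∀ s ∈ M, φ s ∈ G.scalars
  exists_of_map_eq_zero : ∀ a, φ a = 0 → ∃ s ∈ M, s * a = 0
  surj : ∀ b, ∃ s ∈ M, ∃ a, φ s * b = φ a ∧ (star b ∈ G.Λ → star a ∈ F.Λ)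

namespace IsFormLoc

variable {F : FormRing R} {G : FormRing S} {M : Submonoid R} {φ : R →+* S}

/-- Provides one multiplier for finitely many conditions, such as those on the coefficients of a
polynomial or the entries of a matrix. -/
lemma exists_common (h : IsFormLoc F G M φ) {ι : Type*} (t : Finset ι) {P : ι → R → Prop}
    (hP : ∀ k ∈ t, ∃ s ∈ M, P k s) (mul : ∀ k, ∀ s ∈ M, ∀ u ∈ M, P k s → P k (u * s)) :
    ∃ s ∈ M, ∀ k ∈ t, P k s := by
  classical
  induction t using Finset.induction_on with
  | empty => exact ⟨1, one_mem _, by simp⟩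
  | insert a t _ ih =>
    obtain ⟨s, hs, h1⟩ := ih fun k hk => hP k (Finset.mem_insert_of_mem hk)
    obtain ⟨u, hu, h2⟩ := hP a (Finset.mem_insert_self _ _)
    refine ⟨u * s, mul_mem hu hs, fun k hk => ?_⟩
    rcases Finset.mem_insert.1 hk with rfl | hk
    · rw [FormRing.scalars_comm (h.le u hu)]
      exact mul _ _ hu _ hs h2
    · exact mul _ _ hs _ hu (h1 k hk)

lemma poly (h : IsFormLoc F G M φ) :
    IsFormLoc F.poly G.poly (M.map (C : R →+* R[X])) (mapRingHom φ) where
  toIsFormHom := isFormHom_map h.toIsFormHom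
  le := by
    rintro _ ⟨s, hs, rfl⟩
    exact FormRing.C_mem_scalars (h.le s hs)
  map_le := by
    rintro _ ⟨s, hs, rfl⟩
    change (mapRingHom φ) (C s) ∈ _
    rw [coe_mapRingHom, map_C]
    exact FormRing.C_mem_scalars (h.map_le s hs)
  exists_of_map_eq_zero p hp := by
    obtain ⟨s, hs, h1⟩ := h.exists_common p.support (P := fun k s => s * p.coeff k = 0)
      (fun k _ => h.exists_of_map_eq_zero _ (by
        rw [← coeff_map, ← coe_mapRingHom, hp, coeff_zero]))
      (fun k s _ u _ e => by rw [mul_assoc, e, mul_zero])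
    refine ⟨C s, ⟨s, hs, rfl⟩, ?_⟩
    ext k
    rw [coeff_C_mul, coeff_zero]
    by_cases hk : k ∈ p.support
    · exact h1 k hk
    · rw [notMem_support_iff.1 hk, mul_zero]
  surj p := by
    obtain ⟨s, hs, h1⟩ := h.exists_common p.support
      (P := fun k s => ∃ a, φ s * p.coeff k = φ a ∧ (star (p.coeff k) ∈ G.Λ → star a ∈ F.Λ))
      (fun k _ => h.surj _)
      (fun k s _ u hu ⟨a, e, e'⟩ => ⟨u * a, by rw [map_mul, mul_assoc, e, map_mul],
        fun hb => FormRing.scalars_star_mem (h.le u hu) (e' hb)⟩)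
    choose! a ha using h1
    have hc : ∀ k, (∑ k ∈ p.support, monomial k (a k)).coeff k =
        if k ∈ p.support then a k else 0 := by
      intro k
      simp only [finsetSum_coeff, coeff_monomial, Finset.sum_ite_eq']
    refine ⟨C s, ⟨s, hs, rfl⟩, ∑ k ∈ p.support, monomial k (a k), ?_, fun hp => ?_⟩
    · ext k
      rw [coe_mapRingHom, map_C, coeff_C_mul, coeff_map, hc]
      split_ifs with hk
      · exact (ha k hk).1
      · rw [notMem_support_iff.1 hk, mul_zero, map_zero]
    · rw [FormRing.star_mem_poly_Λ] at hp ⊢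
      intro k
      rw [hc]
      split_ifs with hk
      · exact (ha k hk).2 (hp k)
      · rw [star_zero]; exact zero_mem _

/-- The level of the multiples of `φ s`. -/
def level (h : IsFormLoc F G M φ) {s : R} (hs : s ∈ M) : Level G where
  M :=
    { carrier := {z | ∃ y, z = φ (s * y)}
      zero_mem' := ⟨0, by simp⟩
      add_mem' := by
        rintro _ _ ⟨y, rfl⟩ ⟨z, rfl⟩
        exact ⟨y + z, by rw [mul_add, map_add]⟩
      neg_mem' := by
        rintro _ ⟨y, rfl⟩
        exact ⟨-y, by rw [mul_neg, map_neg]⟩ }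
  L :=
    { carrier := {z | ∃ y, star y ∈ F.Λ ∧ z = φ (s * y)}
      zero_mem' := ⟨0, by simp [zero_mem], by simp⟩
      add_mem' := by
        rintro _ _ ⟨y, hy, rfl⟩ ⟨z, hz, rfl⟩
        exact ⟨y + z, by rw [star_add]; exact add_mem hy hz, by rw [mul_add, map_add]⟩
      neg_mem' := by
        rintro _ ⟨y, hy, rfl⟩
        exact ⟨-y, by rw [star_neg]; exact neg_mem hy, by rw [mul_neg, map_neg]⟩ }
  le := by
    rintro _ ⟨y, _, rfl⟩
    exact ⟨y, rfl⟩
  star_mem_Λ := by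
    rintro _ ⟨y, hy, rfl⟩
    exact h.star_mem (FormRing.scalars_star_mem (h.le s hs) hy)
  lam_mul_mem := by
    rintro _ ⟨y, rfl⟩
    exact ⟨F.lam * y, by rw [← h.map_lam, ← map_mul, ← mul_assoc, F.lam_comm, mul_assoc]⟩
  star_mem := by
    rintro _ ⟨y, rfl⟩
    exact ⟨star y, by rw [← h.map_star, FormRing.scalars_star_mul (h.le s hs)]⟩
  sub_tw_mem := by
    rintro _ ⟨y, rfl⟩
    refine ⟨y - F.tw y, (Level.top F).sub_tw_mem y trivial, ?_⟩
    rw [← h.map_tw, ← map_sub, mul_sub, FormRing.tw, FormRing.tw,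
      FormRing.scalars_star_mul (h.le s hs), ← mul_assoc, ← mul_assoc, F.star_lam_comm]

lemma level_adm_iff (h : IsFormLoc F G M φ) {s : R} (hs : s ∈ M) {i j : Fin n ⊕ Fin n} {z : S} :
    (h.level hs).Adm i j z ↔ ∃ y, (i = j → star y ∈ F.Λ) ∧ z = φ (s * y) := by
  constructor
  · rintro ⟨⟨y, rfl⟩, h2⟩
    by_cases e : i = j
    · obtain ⟨y', hy', e'⟩ := h2 e
      exact ⟨y', fun _ => hy', e'⟩
    · exact ⟨y, fun h => absurd h e, rfl⟩
  · rintro ⟨y, hy, rfl⟩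
    exact ⟨⟨y, rfl⟩, fun e => ⟨y, hy e, rfl⟩⟩

lemma level_le_M (h : IsFormLoc F G M φ) {s u : R} (hs : s ∈ M) (hu : u ∈ M) :
    (h.level (mul_mem hu hs)).M ≤ (h.level hs).M := by
  rintro _ ⟨y, rfl⟩
  exact ⟨u * y, by rw [FormRing.scalars_comm (h.le u hu), mul_assoc]⟩

lemma level_le_L (h : IsFormLoc F G M φ) {s u : R} (hs : s ∈ M) (hu : u ∈ M) :
    (h.level (mul_mem hu hs)).L ≤ (h.level hs).L := by
  rintro _ ⟨y, hy, rfl⟩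
  exact ⟨u * y, FormRing.scalars_star_mem (h.le u hu) hy,
    by rw [FormRing.scalars_comm (h.le u hu), mul_assoc]⟩

/-- The products with a fraction of denominator `u`. -/
lemma level_mul (h : IsFormLoc F G M φ) {s u : R} (hs : s ∈ M) (hu : u ∈ M) {x : S} {b : R}
    {P : Prop} (hb : φ u * x = φ b) (hP : P → star b ∈ F.Λ) {i j : Fin n ⊕ Fin n} {z : S}
    (hz : (h.level (mul_mem (mul_mem hu hu) hs)).Adm i j z) :
    (h.level hs).Mul P (i = j) x z := by
  obtain ⟨y, hy, rfl⟩ := (h.level_adm_iff _).1 hz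
  have hu' := h.le u hu
  have hs' := h.le s hs
  have hv : u * u * s ∈ F.scalars := mul_mem (mul_mem hu' hu') hs'
  have hxb : x * φ u = φ b := by rw [← FormRing.scalars_comm (h.map_le u hu), hb]
  have hsb : star x * φ u = φ (star b) := by
    rw [h.map_star, ← hb, star_mul, ← h.map_star, hu'.2.1]
  have hbs : φ u * star x = φ (star b) := by rw [FormRing.scalars_comm (h.map_le u hu), hsb]
  -- A product with `x` uses up one factor `u`. The second is needed for the conjugates `x̄ z x` and
  -- `x z x̄`, in which the denominator of `x` occurs twice.
  have e1 : ∀ y, u * u * s * y = u * (s * (u * y)) := fun y => by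
    rw [mul_assoc u, FormRing.scalars_comm hu' s]
    simp only [mul_assoc]
  have e2 : ∀ y, u * u * s * y = s * (y * u) * u := fun y => by
    rw [e1, FormRing.scalars_comm hu' (_ * _), FormRing.scalars_comm hu' y]
  have e3 : ∀ y, u * u * s * y = u * (s * y) * u := fun y => by
    rw [e2, FormRing.scalars_comm hu' (s * y)]
    simp only [mul_assoc]
  have key : ∀ {x b} (_ : x * φ u = φ b) y, x * φ (u * u * s * y) = φ (s * (b * (u * y))) := by
    intro x b e y
    rw [e1, map_mul, ← mul_assoc, e, ← map_mul, FormRing.scalars_left_comm hs']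
  have key' : ∀ y, φ (u * u * s * y) * x = φ (s * (y * (u * b))) := by
    intro y
    rw [e2, map_mul, mul_assoc, hb, ← map_mul]
    simp only [mul_assoc]
  have e4 : ∀ y z, s * (y * (u * b)) * (u * u * s * z) =
      s * (u * (u * u * s) * (y * b * z)) := by
    intro y z
    generalize u * u * s = v at hv
    rw [FormRing.scalars_left_comm hu', FormRing.scalars_left_comm hv]
    simp only [mul_assoc]
    rw [← FormRing.scalars_left_comm hv s, ← FormRing.scalars_left_comm hv u]
  have hstar : star (φ (u * u * s * y)) = φ (u * u * s * star y) := by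
    rw [← h.map_star, FormRing.scalars_star_mul hv]
  refine ⟨⟨_, key hxb y⟩, ⟨_, key' y⟩, ⟨_, by rw [hstar, key hxb]⟩, ⟨_, key hsb y⟩,
    fun hp => ⟨?_, ?_⟩, fun hq => ⟨?_, ?_⟩⟩
  · exact ⟨_, FormRing.scalars_star_mem (mul_mem hu' hv) (Level.star_conj_mem y (hP hp)),
      by rw [hstar, key', ← map_mul, e4]⟩
  · exact ⟨_, FormRing.scalars_star_mem (mul_mem hu' hv) (Level.conj_star_mem y (hP hp)),
      by rw [hstar, key', ← map_mul, e4]⟩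
  · refine ⟨_, Level.star_conj_mem b (hy hq), ?_⟩
    rw [e3, map_mul, map_mul, ← mul_assoc, ← mul_assoc, hsb, mul_assoc, hb, ← map_mul, ← map_mul,
      FormRing.scalars_left_comm hs', mul_assoc, mul_assoc]
  · refine ⟨_, Level.conj_star_mem b (hy hq), ?_⟩
    rw [e3, map_mul, map_mul, ← mul_assoc, ← mul_assoc, hxb, mul_assoc, hbs, ← map_mul, ← map_mul,
      FormRing.scalars_left_comm hs', mul_assoc, mul_assoc]

lemma grp_level_le (h : IsFormLoc F G M φ) {s : R} (hs : s ∈ M) :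
    (h.level hs).grp (fun _ _ => True) ≤ (eqGrp F n).map (glMap φ) := by
  refine Level.grp_le fun i j z _ hz _ => ?_
  obtain ⟨y, hy, rfl⟩ := (h.level_adm_iff hs).1 hz
  exact ⟨rootT F i j (s * y), Level.rootT_mem_grp ⟨trivial, fun e =>
    FormRing.scalars_star_mem (h.le s hs) (hy e)⟩ fun _ => trivial, glMap_rootT h.toIsFormHom _ _ _⟩

/-- A root element conjugates the group of a sufficiently small level into that of a given one. -/
lemma exists_conj_rootT (h : IsFormLoc F G M φ) (hn : 3 ≤ n) {k l : Fin n ⊕ Fin n}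
    (hq : l ≠ k.swap) {x : S} (hx : k = l → star x ∈ G.Λ) {s : R} (hs : s ∈ M) :
    ∃ t, ∃ ht : t ∈ M, (h.level ht).grp (fun _ _ => True) ≤
      ((h.level hs).grp (fun _ _ => True)).comap (MulAut.conj (rootT G k l x)).toMonoidHom := by
  obtain ⟨u, hu, b, hb, hb'⟩ := h.surj x
  have hr : u * u * s ∈ M := mul_mem (mul_mem hu hu) hs
  have hmul : ∀ i j a, (h.level hr).Adm (n := n) i j a → (h.level hs).Mul (k = l) (i = j) x a :=
    fun i j a ha => h.level_mul hs hu hb (fun e => hb' (hx e)) ha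
  have hM := h.level_le_M hs (mul_mem hu hu)
  have hL := h.level_le_L hs (mul_mem hu hu)
  set r := u * u * s with hrdef
  have hrs := h.le r hr
  -- Three factors serve the decomposition of a long root element, whose argument `-(b̄ a b)` needs
  -- one factor `r` in `a` and one in each `b`.
  have ht : r * r * r ∈ M := mul_mem (mul_mem hr hr) hr
  refine ⟨r * r * r, ht, Level.grp_le fun i j z hp hz _ => ?_⟩
  -- For opposite roots the commutator formula says nothing. The element is split into root elements
  -- of nonzero weight in a coordinate `m` on which both roots vanish, and each piece is conjugated
  -- separately.
  by_cases h1 : (k = i.swap ∧ l = j.swap) ∨ (k = j.swap ∧ l = i.swap)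
  · obtain ⟨y, hy, rfl⟩ := (h.level_adm_iff ht).1 hz
    obtain ⟨m, w1, w2, A, B, K, hA, hB, hK, e⟩ := Level.exists_decomp (V := h.level hr)
      (W := h.level hr) (c := φ (r * r * r * y)) hn hp
      (fun _ => ⟨φ (r * 1), ⟨1, rfl⟩, φ (r * (r * y)), ⟨_, rfl⟩, by
        rw [← map_mul, mul_one, mul_assoc, mul_assoc]⟩)
      (fun e => ⟨φ (r * (-y)), ⟨-y, by rw [star_neg]; exact neg_mem (hy e), rfl⟩, φ (r * 1),
        ⟨1, rfl⟩, ⟨-y * r, by rw [← map_mul, mul_one, mul_assoc]⟩, by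
        rw [← h.map_star, mul_one, hrs.2.1, ← map_mul, ← map_mul, ← map_neg]
        simp only [mul_neg, neg_mul, neg_neg, mul_assoc]
        rw [FormRing.scalars_comm hrs y]⟩)
    have hw : ∀ {m : Fin n ⊕ Fin n}, wt m i = 0 → wt m j = 0 → 0 ≤ wt m k + wt m l := by
      intro m g1 g2
      rcases h1 with ⟨rfl, rfl⟩ | ⟨rfl, rfl⟩ <;> rw [wt_swap, wt_swap, g1, g2] <;> simp
    have hws : ∀ y, wt m y = 0 → wt m.swap y = 0 := by
      intro y hy
      rw [← neg_eq_zero, ← hy, ← wt_swap]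
      simp only [wt, Sum.swap_swap, ← swap_eq_iff (j := m)]
    have conj : ∀ {m : Fin n ⊕ Fin n}, wt m i = 0 → wt m j = 0 → ∀ {g},
        g ∈ (h.level hr).grp (fun i j => 0 < wt m i + wt m j) →
        MulAut.conj (rootT G k l x) g ∈ (h.level hs).grp (fun _ _ => True) := fun g1 g2 _ hg =>
      Level.grp_mono le_rfl le_rfl (fun _ _ _ => trivial)
        (Level.conj_grp_pos (wt_swap _) hq hx (hw g1 g2) hM hL hmul hg)
    rw [Subgroup.mem_comap, e]
    simp only [MulEquiv.coe_toMonoidHom, map_mul, map_commutatorElement]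
    have cA := conj w1 w2 hA
    have cK := conj (hws _ w1) (hws _ w2) hK
    exact mul_mem (conj w1 w2 hB)
      (mul_mem (mul_mem (mul_mem cA cK) (inv_mem cA)) (inv_mem cK))
  · have hz' : (h.level hr).Adm i j z :=
      ⟨h.level_le_M hr (mul_mem hr hr) hz.1, fun e => h.level_le_L hr (mul_mem hr hr) (hz.2 e)⟩
    exact Level.conj_mem hp hq (fun e => h1 (Or.inl e)) (fun e => h1 (Or.inr e)) hx hM hL hz' hmul

end IsFormLoc

/-- Since the inverse of a root element is a root element, induction only has to treat
multiplication by a generator. -/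
lemma Level.grp_induction {F : FormRing R} {V : Level F}
    {Φ : (Fin n ⊕ Fin n) → (Fin n ⊕ Fin n) → Prop} {p : GL (Fin n ⊕ Fin n) R → Prop}
    (one : p 1) (mul : ∀ g i j a, g ∈ V.grp Φ → j ≠ i.swap → V.Adm i j a → Φ i j → p g →
      p (g * rootT F i j a)) {g : GL (Fin n ⊕ Fin n) R} (hg : g ∈ V.grp Φ) : p g := by
  induction hg using Subgroup.closure_induction_right with
  | one => exact one
  | mul_right g hg y hy ih =>
    obtain ⟨i, j, a, h1, h2, h3, rfl⟩ := hy
    exact mul g i j a hg h1 h2 h3 ih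
  | mul_inv_cancel g hg y hy ih =>
    obtain ⟨i, j, a, h1, h2, h3, rfl⟩ := hy
    rw [← rootT_neg]
    exact mul g i j (-a) hg h1 h2.neg h3 ih

/-- An element of the elementary group conjugates the group of a sufficiently small level into that
of a given one. -/
lemma IsFormLoc.exists_conj {F : FormRing R} {G : FormRing S} {M : Submonoid R} {φ : R →+* S}
    (h : IsFormLoc F G M φ) (hn : 3 ≤ n) {g : GL (Fin n ⊕ Fin n) S} (hg : g ∈ eqGrp G n) :
    ∀ {s : R} (hs : s ∈ M), ∃ t, ∃ ht : t ∈ M, (h.level ht).grp (fun _ _ => True) ≤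
      ((h.level hs).grp (fun _ _ => True)).comap (MulAut.conj g).toMonoidHom := by
  refine Level.grp_induction (p := fun g => ∀ {s : R} (hs : s ∈ M), ∃ t, ∃ ht : t ∈ M,
    (h.level ht).grp (fun _ _ => True) ≤
      ((h.level hs).grp (fun _ _ => True)).comap (MulAut.conj g).toMonoidHom) ?_ ?_ hg
  · intro s hs
    refine ⟨s, hs, ?_⟩
    intro x hx
    simpa using hx
  · intro g k l x _ hq hx _ ih s hs
    obtain ⟨t, ht, h1⟩ := ih hs
    obtain ⟨r, hr, h2⟩ := h.exists_conj_rootT hn hq hx.2 ht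
    refine ⟨r, hr, fun z hz => ?_⟩
    simpa [mul_assoc] using h1 (h2 hz)

end Localization

/-! ### The dilation principle -/

section Dilation

variable {R S : Type*} [Ring R] [StarRing R] [Ring S] [StarRing S] {n : ℕ}

/-- The substitution `X ↦ s X`. -/
def dil (F : FormRing R) (s : F.scalars) : R[X] →+* R[X] :=
  evalAt (G := F.poly) C (⟨C s, FormRing.C_mem_scalars s.2⟩ * ⟨X, FormRing.X_mem_scalars⟩)

/-- The constant term, as an endomorphism of `R[X]`. -/
def cst (F : FormRing R) : R[X] →+* R[X] := evalAt (G := F.poly) C 0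

section

variable {F : FormRing R} {G : FormRing S}

@[simp] lemma dil_C (s : F.scalars) (a : R) : dil F s (C a) = C a := evalAt_C ..

@[simp] lemma dil_X (s : F.scalars) : dil F s X = C (s : R) * X := evalAt_X ..

@[simp] lemma cst_C (a : R) : cst F (C a) = C a := evalAt_C ..

@[simp] lemma cst_X : cst F X = 0 := evalAt_X ..

lemma cst_eq (p : R[X]) : cst F p = C (p.coeff 0) := by
  conv_lhs => rw [← divX_mul_X_add p]
  simp

lemma isFormHom_dil (s : F.scalars) : IsFormHom F.poly F.poly (dil F s) :=
  isFormHom_evalAt (isFormHom_C F)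

lemma isFormHom_cst : IsFormHom F.poly F.poly (cst F) := isFormHom_evalAt (isFormHom_C F)

lemma dil_comp_dil (s t : F.scalars) : (dil F s).comp (dil F t) = dil F (s * t) := by
  refine Polynomial.ringHom_ext (fun a => by simp) ?_
  simp only [RingHom.comp_apply, dil_X, map_mul, dil_C, Subring.coe_mul]
  rw [← mul_assoc, FormRing.scalars_comm (FormRing.C_mem_scalars s.2)]

lemma dil_comp_cst (s : F.scalars) : (dil F s).comp (cst F) = cst F :=
  Polynomial.ringHom_ext (fun a => by simp) (by simp)

lemma cst_comp_dil (s : F.scalars) : (cst F).comp (dil F s) = cst F :=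
  Polynomial.ringHom_ext (fun a => by simp) (by simp)

lemma map_comp_dil {φ : R →+* S} (s : F.scalars) (h : φ s ∈ G.scalars) :
    (mapRingHom φ).comp (dil F s) = (dil G ⟨φ s, h⟩).comp (mapRingHom φ) :=
  Polynomial.ringHom_ext (fun a => by simp) (by simp)

lemma map_comp_cst {φ : R →+* S} :
    (mapRingHom φ).comp (cst F) = (cst G).comp (mapRingHom φ) :=
  Polynomial.ringHom_ext (fun a => by simp) (by simp)

lemma star_divX_mem {p : R[X]} (h : star p ∈ F.poly.Λ) : star (divX p) ∈ F.poly.Λ := by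
  rw [FormRing.star_mem_poly_Λ] at h ⊢
  intro k
  rw [coeff_divX]
  exact h _

end

variable {F : FormRing R} {G : FormRing S} {M : Submonoid R} {φ : R →+* S}

/-- An element of the elementary group over `S[X]`, divided by its constant term, is defined over
`R[X]` after a substitution `X ↦ s X`. -/
lemma IsFormLoc.exists_dil (h : IsFormLoc F G M φ) (hn : 3 ≤ n) {g : GL (Fin n ⊕ Fin n) S[X]}
    (hg : g ∈ eqGrp G.poly n) : ∃ s, ∃ hs : s ∈ M, ∃ e ∈ eqGrp F.poly n,
      glMap (dil G ⟨φ s, h.map_le s hs⟩) (g * (glMap (cst G) g)⁻¹) = glMap (mapRingHom φ) e := by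
  refine Level.grp_induction (p := fun g => ∃ s, ∃ hs : s ∈ M, ∃ e ∈ eqGrp F.poly n,
      glMap (dil G ⟨φ s, h.map_le s hs⟩) (g * (glMap (cst G) g)⁻¹) = glMap (mapRingHom φ) e) ?_ ?_ hg
  · exact ⟨1, one_mem _, 1, one_mem _, by simp⟩
  rintro g i j f hg hp hf - ⟨s₀, hs₀, e₀, he₀, h₀⟩
  have hgc : glMap (cst G) g ∈ eqGrp G.poly n := isFormHom_cst.map_eqGrp hg
  -- Write `x` for the new root element `rootT G.poly i j f`. Then `g x (g(0) x(0))⁻¹` is `g g(0)⁻¹`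
  -- times the conjugate of `x x(0)⁻¹` by `g(0)`. The scalar `t` pays for this conjugation, `u` is a
  -- denominator of `divX f`, and `s₀` handles the first factor by induction.
  obtain ⟨_, ⟨t, ht, rfl⟩, hconj⟩ := h.poly.exists_conj hn hgc (one_mem _)
  obtain ⟨_, ⟨u, hu, rfl⟩, q, hq, hq'⟩ := h.poly.surj (divX f)
  have hs : t * u * s₀ ∈ M := mul_mem (mul_mem ht hu) hs₀
  set s : F.scalars := ⟨t * u * s₀, h.le _ hs⟩ with hsdef
  set s' : G.scalars := ⟨φ (t * u * s₀), h.map_le _ hs⟩ with hs'def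
  have hdil : (mapRingHom φ).comp (dil F s) = (dil G s').comp (mapRingHom φ) := map_comp_dil s _
  have e1 : glMap (dil G s') (g * (glMap (cst G) g)⁻¹) ∈ (eqGrp F.poly n).map
      (glMap (mapRingHom φ)) := by
    have htu : t * u ∈ M := mul_mem ht hu
    refine ⟨glMap (dil F ⟨t * u, h.le _ htu⟩) e₀, (isFormHom_dil _).map_eqGrp he₀, ?_⟩
    rw [glMap_glMap, map_comp_dil (G := G) _ (h.map_le _ htu), ← glMap_glMap, ← h₀, glMap_glMap,
      dil_comp_dil]
    congr 3
    exact Subtype.ext (map_mul φ _ _).symm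
  have e2 : glMap (dil G s') (glMap (cst G) g * rootT G.poly i j (f - cst G f) *
      (glMap (cst G) g)⁻¹) ∈ (eqGrp F.poly n).map (glMap (mapRingHom φ)) := by
    rw [map_mul, map_mul, map_inv, glMap_glMap, dil_comp_cst, glMap_rootT (isFormHom_dil _)]
    -- The substitution creates a factor `t u s₀` in front of `X`. The part `u` clears the
    -- denominator, and `t` remains as the level required for the conjugation.
    have hf' : dil G s' (f - cst G f) = mapRingHom φ (C t * (X * (C s₀ * dil F s q))) := by
      have : f - cst G f = X * divX f := by
        rw [cst_eq, sub_eq_iff_eq_add, X_mul, divX_mul_X_add]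
      rw [this, map_mul, dil_X]
      have hq2 : dil G s' (C (φ u) * divX f) = mapRingHom φ (dil F s q) := by
        have : C (φ u) = mapRingHom φ (C u) := by simp
        rw [this]
        erw [hq]
        exact (congrArg (fun f => f q) hdil).symm
      rw [map_mul, map_mul, map_mul, ← hq2, map_mul, dil_C]
      simp only [coe_mapRingHom, map_C, map_X, hs'def, map_mul]
      have hU := FormRing.C_mem_scalars (h.map_le _ hu)
      have hX := FormRing.X_mem_scalars (F := G)
      simp only [mul_assoc]
      rw [← FormRing.scalars_left_comm hU (C (φ s₀)), ← FormRing.scalars_left_comm hX (C (φ s₀)),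
        ← FormRing.scalars_left_comm hX (C (φ u))]
    refine h.poly.grp_level_le (one_mem _) (hconj ?_)
    rw [hf']
    refine Level.rootT_mem_grp ((h.poly.level_adm_iff _).2 ⟨_, fun e => ?_, rfl⟩) fun _ => trivial
    exact FormRing.scalars_star_mem FormRing.X_mem_scalars (FormRing.scalars_star_mem
      (FormRing.C_mem_scalars (h.le _ hs₀)) ((isFormHom_dil s).star_mem
        (hq' (star_divX_mem (hf.2 e)))))
  obtain ⟨e, he, he'⟩ := mul_mem e1 e2
  refine ⟨t * u * s₀, hs, e, he, ?_⟩
  rw [he', ← map_mul]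
  congr 1
  rw [map_mul, glMap_rootT isFormHom_cst, sub_eq_add_neg, rootT_add, rootT_neg]
  group

/-- The dilation principle. -/
theorem IsFormLoc.dilation (h : IsFormLoc F G M φ) (hn : 3 ≤ n) {g : GL (Fin n ⊕ Fin n) R[X]}
    (hg : glMap (cst F) g = 1) (hφ : glMap (mapRingHom φ) g ∈ eqGrp G.poly n) :
    ∃ s : F.scalars, (s : R) ∈ M ∧ glMap (dil F s) g ∈ eqGrp F.poly n := by
  obtain ⟨s, hs, e, he, hse⟩ := h.exists_dil hn hφ
  have hc : glMap (cst G) (glMap (mapRingHom φ) g) = 1 := by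
    rw [glMap_glMap, ← map_comp_cst (F := F), ← glMap_glMap, hg, map_one]
  rw [hc, inv_one, mul_one, glMap_glMap, ← map_comp_dil ⟨s, h.le s hs⟩, ← glMap_glMap] at hse
  set s₁ : F.scalars := ⟨s, h.le s hs⟩
  -- Normalizing the constant term makes the difference of `e'` and the dilated `g` divisible by
  -- `X`. A scalar that kills this difference then acts through the substitution of `X`.
  set e' := e * (glMap (cst F) e)⁻¹ with he'def
  have he' : e' ∈ eqGrp F.poly n := mul_mem he (inv_mem (isFormHom_cst.map_eqGrp he))
  have hee : glMap (mapRingHom φ) e' = glMap (mapRingHom φ) (glMap (dil F s₁) g) := by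
    rw [he'def, map_mul, map_inv, glMap_glMap, map_comp_cst (G := G), ← glMap_glMap, ← hse,
      glMap_glMap (cst G), ← map_comp_cst (F := F), ← glMap_glMap _ (cst F), glMap_glMap (cst F), cst_comp_dil, hg,
      map_one, inv_one, mul_one]
  have hce : glMap (cst F) e' = glMap (cst F) (glMap (dil F s₁) g) := by
    have : (cst F).comp (cst F) = cst F :=
      Polynomial.ringHom_ext (fun a => by simp) (by simp)
    rw [he'def, map_mul, map_inv, glMap_glMap, glMap_glMap, this, cst_comp_dil, hg, mul_inv_cancel]
  obtain ⟨_, ⟨t, ht, rfl⟩, hkill⟩ := h.poly.exists_common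
    (Finset.univ : Finset ((Fin n ⊕ Fin n) × (Fin n ⊕ Fin n)))
    (P := fun k c => c * (e'.val k.1 k.2 - (glMap (dil F s₁) g).val k.1 k.2) = 0)
    (fun k _ => h.poly.exists_of_map_eq_zero _ (by
      rw [map_sub, sub_eq_zero]
      have := congrArg (fun z : GL (Fin n ⊕ Fin n) S[X] => z.val k.1 k.2) hee
      exact this))
    (fun k s _ u _ e => by rw [mul_assoc, e, mul_zero])
  refine ⟨⟨t, h.le t ht⟩ * s₁, mul_mem ht hs, ?_⟩
  rw [← dil_comp_dil, ← glMap_glMap]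
  have : glMap (dil F ⟨t, h.le t ht⟩) (glMap (dil F s₁) g) = glMap (dil F ⟨t, h.le t ht⟩) e' := by
    ext1
    ext1 i j
    change dil F ⟨t, h.le t ht⟩ ((glMap (dil F s₁) g).val i j) =
      dil F ⟨t, h.le t ht⟩ (e'.val i j)
    rw [eq_comm, ← sub_eq_zero, ← map_sub]
    have h1 := hkill (i, j) (Finset.mem_univ _)
    have h2 : (cst F) (e'.val i j - (glMap (dil F s₁) g).val i j) = 0 := by
      rw [map_sub, sub_eq_zero]
      have := congrArg (fun z : GL (Fin n ⊕ Fin n) R[X] => z.val i j) hce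
      exact this
    simp only at h1
    generalize e'.val i j - (glMap (dil F s₁) g).val i j = d at h1 h2
    rw [cst_eq] at h2
    -- Under `X ↦ tX` the factor `X` contributes `t`, which annihilates `divX d`.
    have h3 : d = X * divX d := by
      conv_lhs => rw [← divX_mul_X_add d, h2, add_zero, ← X_mul]
    have h4 : C t * divX d = 0 := by
      ext k
      have := congrArg (fun p => coeff p (k + 1)) h1
      simpa [coeff_divX] using this
    rw [h3, map_mul, dil_X, FormRing.scalars_comm (FormRing.C_mem_scalars (h.le t ht)),
      mul_assoc, ← dil_C (F := F) ⟨t, h.le t ht⟩ t, ← map_mul, h4, map_zero, mul_zero]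
  rw [this]
  exact (isFormHom_dil _).map_eqGrp he'

end Dilation

/-! ### Patching: the absolute local-global principle -/

section LocalGlobal

variable {R S : Type*} [Ring R] [StarRing R] [Ring S] [StarRing S] {n : ℕ}

/-- The translation `X ↦ X + Y`. -/
def trans (F : FormRing R) : R[X] →+* R[X][X] :=
  evalAt (G := F.poly.poly) (C.comp C)
    (⟨C X, FormRing.C_mem_scalars FormRing.X_mem_scalars⟩ + ⟨X, FormRing.X_mem_scalars⟩)

variable {F : FormRing R} {G : FormRing S} {M : Submonoid R} {φ : R →+* S}

@[simp] lemma trans_C (a : R) : trans F (C a) = C (C a) := evalAt_C ..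

@[simp] lemma trans_X : trans F X = C X + X := evalAt_X ..

lemma isFormHom_trans : IsFormHom F.poly F.poly.poly (trans F) :=
  isFormHom_evalAt ((isFormHom_C F.poly).comp (isFormHom_C F))

/-- Local membership in the elementary group and congruent substitutions. -/
lemma IsFormLoc.exists_congruent (h : IsFormLoc F G M φ) (hn : 3 ≤ n)
    {g : GL (Fin n ⊕ Fin n) R[X]} (hφ : glMap (mapRingHom φ) g ∈ eqGrp G.poly n) :
    ∃ s : F.scalars, (s : R) ∈ M ∧ ∀ c d : F.scalars,
      glMap (dil F (c * s + d)) g * (glMap (dil F d) g)⁻¹ ∈ eqGrp F.poly n := by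
  -- Dilation is applied in the variable `Y` to `g(X + Y) g(X)⁻¹`, which is `1` at `Y = 0`.
  have h0 : glMap (cst F.poly) (glMap (trans F) g * (glMap C g)⁻¹) = 1 := by
    have e1 : (cst F.poly).comp (trans F) = C := Polynomial.ringHom_ext (by simp) (by simp)
    have e2 : (cst F.poly).comp C = C := Polynomial.ringHom_ext (by simp) (by simp)
    rw [map_mul, map_inv, glMap_glMap, glMap_glMap, e1, e2, mul_inv_cancel]
  have h1 : glMap (mapRingHom (mapRingHom φ)) (glMap (trans F) g * (glMap C g)⁻¹) ∈
      eqGrp G.poly.poly n := by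
    have e1 : (mapRingHom (mapRingHom φ)).comp (trans F) = (trans G).comp (mapRingHom φ) :=
      Polynomial.ringHom_ext (by simp) (by simp)
    have e2 : (mapRingHom (mapRingHom φ)).comp C = (C : S[X] →+* S[X][X]).comp (mapRingHom φ) :=
      Polynomial.ringHom_ext (by simp) (by simp)
    rw [map_mul, map_inv, glMap_glMap, glMap_glMap, e1, e2, ← glMap_glMap, ← glMap_glMap C]
    exact mul_mem (isFormHom_trans.map_eqGrp hφ)
      (inv_mem ((isFormHom_C G.poly).map_eqGrp hφ))
  obtain ⟨⟨_, hs'⟩, ⟨s, hs, rfl⟩, h2⟩ := h.poly.dilation hn h0 h1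
  refine ⟨⟨s, h.le s hs⟩, hs, fun c d => ?_⟩
  -- The simultaneous substitution `X ↦ dX`, `Y ↦ cX` sends `X + sY` to `(cs + d)X`.
  set x : F.poly.scalars := ⟨C (c : R), FormRing.C_mem_scalars c.2⟩ * ⟨X, FormRing.X_mem_scalars⟩
  have hx : (x : R[X]) = C (c : R) * X := rfl
  have h3 := (isFormHom_evalAt (x := x) (isFormHom_dil d)).map_eqGrp h2
  have e1 : (evalAt (dil F d) x).comp ((dil F.poly ⟨C s, hs'⟩).comp (trans F)) =
      dil F (c * ⟨s, h.le s hs⟩ + d) := by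
    refine Polynomial.ringHom_ext (by simp) ?_
    simp [hx, add_mul]
    rw [← mul_assoc, FormRing.scalars_comm hs', add_comm]
  have e2 : (evalAt (dil F d) x).comp ((dil F.poly ⟨C s, hs'⟩).comp C) = dil F d :=
    Polynomial.ringHom_ext (by simp) (by simp)
  rw [map_mul, map_mul, map_inv, map_inv, glMap_glMap (dil _ _), glMap_glMap (dil _ _),
    glMap_glMap, glMap_glMap, e1, e2] at h3
  exact h3

/-- The ideal of the scalars `b` such that substitutions of `X` that are congruent modulo `b`
agree modulo the elementary group. -/
def congruentIdeal {K : Type*} [CommRing K] (ι : K →+* F.scalars)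
    (g : GL (Fin n ⊕ Fin n) R[X]) : Ideal K where
  carrier := {b | ∀ c d : K,
    glMap (dil F (ι (c * b + d))) g * (glMap (dil F (ι d)) g)⁻¹ ∈ eqGrp F.poly n}
  zero_mem' c d := by simp
  add_mem' := by
    intro b b' hb hb' c d
    -- The step from `d` to `c(b + b') + d` is made through the intermediate point `cb' + d`.
    have := mul_mem (hb c (c * b' + d)) (hb' c d)
    rw [← mul_assoc, inv_mul_cancel_right, ← add_assoc, ← mul_add] at this
    exact this
  smul_mem' := by
    intro a b hb c d
    rw [smul_eq_mul, ← mul_assoc]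
    exact hb _ _

/-- The absolute local-global principle. -/
theorem mem_eqGrp_of_local {K : Type*} [CommRing K] (ι : K →+* F.scalars)
    {g : GL (Fin n ⊕ Fin n) R[X]} (h0 : glMap (cst F) g = 1)
    (h : ∀ P : Ideal K, P.IsMaximal → ∃ b ∉ P, ∀ c d : K,
      glMap (dil F (ι (c * b + d))) g * (glMap (dil F (ι d)) g)⁻¹ ∈ eqGrp F.poly n) :
    g ∈ eqGrp F.poly n := by
  have htop : congruentIdeal ι g = ⊤ := by
    by_contra hne
    obtain ⟨P, hP, hle⟩ := Ideal.exists_le_maximal _ hne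
    obtain ⟨b, hb, hb'⟩ := h P hP
    exact hb (hle hb')
  have h1 : (1 : K) ∈ congruentIdeal ι g := htop ▸ trivial
  -- Comparing the substitutions `X ↦ X` and `X ↦ 0` gives `g g(0)⁻¹ = g`.
  have := h1 1 0
  have e1 : dil F (ι (1 * 1 + 0)) = RingHom.id _ :=
    Polynomial.ringHom_ext (by simp) (by simp)
  have e2 : dil F (ι 0) = cst F := Polynomial.ringHom_ext (by simp) (by simp)
  rw [e1, e2, h0, inv_one, mul_one] at this
  exact this

end LocalGlobal

/-! ### Extensions of ideals to polynomials and localizations -/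

section Ideals

variable {R S : Type*} [Ring R] [StarRing R] [Ring S] [StarRing S]

lemma coeff_mem_of_mem_map_C {J : TwoSidedIdeal R} {p : R[X]} (hp : p ∈ J.map C) (k : ℕ) :
    p.coeff k ∈ J := by
  have h : ∀ k, p.coeff k ∈ J := by
    refine TwoSidedIdeal.span_induction (p := fun p _ => ∀ k, p.coeff k ∈ J) ?_ ?_ ?_ ?_ ?_ ?_ hp
    · rintro _ ⟨a, ha, rfl⟩ k
      rw [coeff_C]
      split_ifs
      exacts [ha, zero_mem _]
    · intro k; rw [coeff_zero]; exact zero_mem _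
    · intro p q _ _ hp hq k; rw [coeff_add]; exact add_mem (hp k) (hq k)
    · intro p _ hp k; rw [coeff_neg]; exact neg_mem (hp k)
    · intro q p _ hp k
      rw [coeff_mul]
      exact sum_mem fun x _ => J.mul_mem_left _ _ (hp _)
    · intro q p _ hp k
      rw [coeff_mul]
      exact sum_mem fun x _ => J.mul_mem_right _ _ (hp _)
  exact h k

lemma mem_map_C_of_coeff_mem {J : TwoSidedIdeal R} {p : R[X]} (hp : ∀ k, p.coeff k ∈ J) :
    p ∈ J.map C := by
  rw [← sum_C_mul_X_pow_eq p, Polynomial.sum]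
  exact sum_mem fun k _ => TwoSidedIdeal.mul_mem_right _ _ _
    (TwoSidedIdeal.subset_span ⟨_, hp k, rfl⟩)

lemma star_mem_map_C {J : TwoSidedIdeal R} (hJ : ∀ a ∈ J, star a ∈ J) :
    ∀ p ∈ J.map (C : R →+* R[X]), star p ∈ J.map (C : R →+* R[X]) := fun p hp =>
  mem_map_C_of_coeff_mem fun k => by
    rw [coeff_star]
    exact hJ _ (coeff_mem_of_mem_map_C hp k)

variable {F : FormRing R} {G : FormRing S} {M : Submonoid R} {φ : R →+* S}

lemma IsFormHom.star_mem_map (h : IsFormHom F G φ) {J : TwoSidedIdeal R}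
    (hJ : ∀ a ∈ J, star a ∈ J) : ∀ x ∈ J.map φ, star x ∈ J.map φ := by
  intro x hx
  refine TwoSidedIdeal.span_induction (p := fun x _ => star x ∈ J.map φ) ?_ ?_ ?_ ?_ ?_ ?_ hx
  · rintro _ ⟨a, ha, rfl⟩
    rw [← h.map_star]
    exact TwoSidedIdeal.subset_span ⟨_, hJ a ha, rfl⟩
  · rw [star_zero]; exact zero_mem _
  · intro p q _ _ hp hq; rw [star_add]; exact add_mem hp hq
  · intro p _ hp; rw [star_neg]; exact neg_mem hp
  · intro q p _ hp
    rw [star_mul]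
    exact TwoSidedIdeal.mul_mem_right _ _ _ hp
  · intro q p _ hp
    rw [star_mul]
    exact TwoSidedIdeal.mul_mem_left _ _ _ hp

lemma IsFormLoc.exists_of_mem_map (h : IsFormLoc F G M φ) {J : TwoSidedIdeal R} {x : S}
    (hx : x ∈ J.map φ) : ∃ s ∈ M, ∃ a ∈ J, φ s * x = φ a := by
  refine TwoSidedIdeal.span_induction (p := fun x _ => ∃ s ∈ M, ∃ a ∈ J, φ s * x = φ a)
    ?_ ?_ ?_ ?_ ?_ ?_ hx
  · rintro _ ⟨a, ha, rfl⟩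
    exact ⟨1, one_mem _, a, ha, by simp⟩
  · exact ⟨1, one_mem _, 0, zero_mem _, by simp⟩
  · rintro x y _ _ ⟨s, hs, a, ha, e⟩ ⟨t, ht, b, hb, e'⟩
    refine ⟨s * t, mul_mem hs ht, t * a + s * b,
      add_mem (J.mul_mem_left _ _ ha) (J.mul_mem_left _ _ hb), ?_⟩
    rw [mul_add, map_add, map_mul, map_mul, map_mul, ← e, ← e', ← mul_assoc, ← mul_assoc,
      FormRing.scalars_comm (h.map_le s hs) (φ t)]
  · rintro x _ ⟨s, hs, a, ha, e⟩
    exact ⟨s, hs, -a, neg_mem ha, by rw [mul_neg, e, map_neg]⟩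
  · rintro y x _ ⟨s, hs, a, ha, e⟩
    obtain ⟨t, ht, b, e', -⟩ := h.surj y
    refine ⟨t * s, mul_mem ht hs, b * a, J.mul_mem_left _ _ ha, ?_⟩
    rw [map_mul, map_mul, ← e, ← e', mul_assoc, mul_assoc,
      FormRing.scalars_left_comm (h.map_le s hs) y]
  · rintro y x _ ⟨s, hs, a, ha, e⟩
    obtain ⟨t, ht, b, e', -⟩ := h.surj y
    refine ⟨t * s, mul_mem ht hs, a * b, J.mul_mem_right _ _ ha, ?_⟩
    rw [map_mul, map_mul, ← e, ← e', FormRing.scalars_left_comm (h.map_le t ht)]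
    simp only [mul_assoc]

end Ideals

/-! ### The double along an ideal and its localization -/

section Double

variable {R S : Type*} [Ring R] [StarRing R] [Ring S] [StarRing S] {n : ℕ}

/-- The double of `R` along the involution-invariant ideal `J`: the pairs of elements that are
congruent modulo `J`. -/
def double (J : TwoSidedIdeal R) (_ : ∀ a ∈ J, star a ∈ J) : Subring (R × R) where
  carrier := {x | x.1 - x.2 ∈ J}
  zero_mem' := by simp [zero_mem]
  one_mem' := by simp [zero_mem]
  add_mem' := by
    intro x y hx hy
    have e : (x + y).1 - (x + y).2 = (x.1 - x.2) + (y.1 - y.2) := by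
      simp only [Prod.fst_add, Prod.snd_add]; abel
    change (x + y).1 - (x + y).2 ∈ J
    rw [e]
    exact add_mem hx hy
  neg_mem' := by
    intro x hx
    have e : (-x).1 - (-x).2 = -(x.1 - x.2) := by
      simp only [Prod.fst_neg, Prod.snd_neg]; abel
    change (-x).1 - (-x).2 ∈ J
    rw [e]
    exact neg_mem hx
  mul_mem' := by
    intro x y hx hy
    have e : (x * y).1 - (x * y).2 = x.1 * (y.1 - y.2) + (x.1 - x.2) * y.2 := by
      simp only [Prod.fst_mul, Prod.snd_mul]; noncomm_ring
    change (x * y).1 - (x * y).2 ∈ J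
    rw [e]
    exact add_mem (J.mul_mem_left _ _ hy) (J.mul_mem_right _ _ hx)

variable {J : TwoSidedIdeal R} {hJ : ∀ a ∈ J, star a ∈ J}

lemma mem_double {x : R × R} : x ∈ double J hJ ↔ x.1 - x.2 ∈ J := Iff.rfl

instance doubleStarRing : StarRing (double J hJ) where
  star x := ⟨star x.1, by
    rw [mem_double, Prod.fst_star, Prod.snd_star, ← star_sub]
    exact hJ _ x.2⟩
  star_involutive x := Subtype.ext (star_star x.1)
  star_mul x y := Subtype.ext (star_mul x.1 y.1)
  star_add x y := Subtype.ext (star_add x.1 y.1)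

/-- The form ring on the double. -/
def FormRing.double (F : FormRing R) (hJ : ∀ a ∈ J, star a ∈ J) : FormRing (double J hJ) where
  lam := ⟨(F.lam, F.lam), by rw [mem_double, sub_self]; exact zero_mem _⟩
  lam_mem_center := Subring.mem_center_iff.2 fun x => Subtype.ext (Prod.ext
    (Subring.mem_center_iff.1 F.lam_mem_center _) (Subring.mem_center_iff.1 F.lam_mem_center _))
  lam_mul_star := Subtype.ext (Prod.ext F.lam_mul_star F.lam_mul_star)
  Λ :=
    { carrier := {x | x.1.1 ∈ F.Λ ∧ x.1.2 ∈ F.Λ}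
      zero_mem' := ⟨zero_mem _, zero_mem _⟩
      add_mem' := fun h h' => ⟨add_mem h.1 h'.1, add_mem h.2 h'.2⟩
      neg_mem' := fun h => ⟨neg_mem h.1, neg_mem h.2⟩ }
  min_mem x := ⟨F.min_mem _, F.min_mem _⟩
  eq_of_mem _ hx := Subtype.ext (Prod.ext (F.eq_of_mem _ hx.1) (F.eq_of_mem _ hx.2))
  conj_mem x a ha := ⟨F.conj_mem _ _ ha.1, F.conj_mem _ _ ha.2⟩

variable (J hJ) in
/-- The first projection of the double. -/
def fstHom : double J hJ →+* R := (RingHom.fst R R).comp (double J hJ).subtype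

variable (J hJ) in
/-- The second projection of the double. -/
def sndHom : double J hJ →+* R := (RingHom.snd R R).comp (double J hJ).subtype

variable (J hJ) in
/-- The diagonal of the double. -/
def diagHom : R →+* double J hJ :=
  ((RingHom.id R).prod (RingHom.id R)).codRestrict (double J hJ) fun x => by
    rw [mem_double]
    simp [zero_mem]

variable {F : FormRing R}

lemma isFormHom_fst : IsFormHom (F.double hJ) F (fstHom J hJ) := ⟨fun _ => rfl, rfl, fun _ h => h.1⟩

lemma isFormHom_snd : IsFormHom (F.double hJ) F (sndHom J hJ) := ⟨fun _ => rfl, rfl, fun _ h => h.2⟩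

lemma double_ext {x y : double J hJ} (h1 : fstHom J hJ x = fstHom J hJ y)
    (h2 : sndHom J hJ x = sndHom J hJ y) : x = y := Subtype.ext (Prod.ext h1 h2)

lemma diag_mem_scalars {s : R} (hs : s ∈ F.scalars) : diagHom J hJ s ∈ (F.double hJ).scalars :=
  ⟨Subring.mem_center_iff.2 fun _ => Subtype.ext (Prod.ext
    (Subring.mem_center_iff.1 hs.1 _) (Subring.mem_center_iff.1 hs.1 _)),
    Subtype.ext (Prod.ext hs.2.1 hs.2.1), fun _ ha => ⟨hs.2.2 _ ha.1, hs.2.2 _ ha.2⟩⟩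

variable {G : FormRing S} {M : Submonoid R} {φ : R →+* S}

/-- The homomorphism of doubles. -/
def doubleMap (φ : R →+* S) (hJ : ∀ a ∈ J, star a ∈ J) (hJ' : ∀ a ∈ J.map φ, star a ∈ J.map φ) :
    double J hJ →+* double (J.map φ) hJ' :=
  ((φ.prodMap φ).comp (double J hJ).subtype).codRestrict (double (J.map φ) hJ') fun x => by
    rw [mem_double]
    change φ x.1.1 - φ x.1.2 ∈ _
    rw [← map_sub]
    exact TwoSidedIdeal.subset_span ⟨_, x.2, rfl⟩

/-- Doubling commutes with localization, so the absolute principle can be applied to the double with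
the diagonal scalars. -/
lemma IsFormLoc.double (h : IsFormLoc F G M φ) (hJ : ∀ a ∈ J, star a ∈ J)
    (hJ' : ∀ a ∈ J.map φ, star a ∈ J.map φ) :
    IsFormLoc (F.double hJ) (G.double hJ') (M.map (diagHom J hJ)) (doubleMap φ hJ hJ') where
  map_star x := Subtype.ext (Prod.ext (h.map_star _) (h.map_star _))
  map_lam := Subtype.ext (Prod.ext h.map_lam h.map_lam)
  map_mem x hx := ⟨h.map_mem _ hx.1, h.map_mem _ hx.2⟩
  le := by
    rintro _ ⟨s, hs, rfl⟩
    exact diag_mem_scalars (h.le s hs)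
  map_le := by
    rintro _ ⟨s, hs, rfl⟩
    exact diag_mem_scalars (h.map_le s hs)
  exists_of_map_eq_zero x hx := by
    have hx' := congrArg Subtype.val hx
    obtain ⟨s, hs, e1⟩ := h.exists_of_map_eq_zero x.1.1 (congrArg Prod.fst hx')
    obtain ⟨t, ht, e2⟩ := h.exists_of_map_eq_zero x.1.2 (congrArg Prod.snd hx')
    refine ⟨_, ⟨s * t, mul_mem hs ht, rfl⟩, Subtype.ext (Prod.ext ?_ ?_)⟩
    · change s * t * x.1.1 = 0
      rw [FormRing.scalars_comm (h.le s hs), mul_assoc, e1, mul_zero]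
    · change s * t * x.1.2 = 0
      rw [mul_assoc, e2, mul_zero]
  surj x := by
    obtain ⟨s, hs, a, ea, ha⟩ := h.surj x.1.1
    obtain ⟨t, ht, b, eb, hb⟩ := h.surj x.1.2
    obtain ⟨u, hu, j, hj, ej⟩ := h.exists_of_mem_map x.2
    have cs := FormRing.scalars_comm (h.le s hs)
    have ct := FormRing.scalars_comm (h.le t ht)
    have cu := FormRing.scalars_comm (h.le u hu)
    -- The fractions `a/s` and `b/t` differ by `j/u` with `j ∈ J`. This holds over `R` only after
    -- multiplication by some `v`; over the common denominator `v u s t` the numerators then differ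
    -- by an element of `J`.
    obtain ⟨v, hv, ev⟩ := h.exists_of_map_eq_zero (u * t * a - u * s * b - s * t * j) (by
      have cs := FormRing.scalars_comm (h.map_le s hs)
      have ct := FormRing.scalars_comm (h.map_le t ht)
      have cu := FormRing.scalars_comm (h.map_le u hu)
      simp only [map_sub, map_mul, ← ea, ← eb, ← ej]
      rw [mul_assoc _ (φ t), ← mul_assoc (φ t), ct (φ s), mul_assoc (φ u) (φ s),
        ← mul_assoc (φ s) (φ t), ← mul_assoc (φ s * φ t) (φ u), ← cu, mul_assoc (φ u),
        ← mul_sub, ← mul_sub, mul_sub (φ s * φ t), sub_self, mul_zero])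
    have hut := mul_mem (mul_mem hv hu) ht
    have hus := mul_mem (mul_mem hv hu) hs
    refine ⟨_, ⟨v * u * (s * t), mul_mem (mul_mem hv hu) (mul_mem hs ht), rfl⟩,
      ⟨(v * u * t * a, v * u * s * b), ?_⟩, Subtype.ext (Prod.ext ?_ ?_), fun hx => ⟨?_, ?_⟩⟩
    · rw [mem_double]
      rw [mul_sub, sub_eq_zero] at ev
      have e : v * u * t * a - v * u * s * b = v * (s * t * j) := by
        rw [← ev, mul_sub]
        simp only [mul_assoc]
      simp only [e]
      exact J.mul_mem_left _ _ (J.mul_mem_left _ _ hj)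
    · change φ (v * u * (s * t)) * x.1.1 = φ (v * u * t * a)
      rw [cs, ← mul_assoc, map_mul, map_mul _ _ a, mul_assoc, ea]
    · change φ (v * u * (s * t)) * x.1.2 = φ (v * u * s * b)
      rw [← mul_assoc, map_mul, map_mul _ _ b, mul_assoc, eb]
    · exact FormRing.scalars_star_mem (h.le _ hut) (ha hx.1)
    · exact FormRing.scalars_star_mem (h.le _ hus) (hb hx.2)

end Double

/-! ### Localization at a maximal ideal of the centre as a localization at scalars -/

section Base

variable {R : Type*} [Ring R] [StarRing R]

/-- The scalars outside of the maximal ideal `m`. -/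
def scalarsOutside (F : FormRing R) (m : MaximalSpectrum (Subring.center R)) : Submonoid R where
  carrier := {x | x ∈ F.scalars ∧ ∃ c : Subring.center R, c ∉ m.asIdeal ∧ (c : R) = x}
  one_mem' := ⟨one_mem _, 1, fun h => m.isMaximal.ne_top ((Ideal.eq_top_iff_one _).2 h), rfl⟩
  mul_mem' := by
    rintro _ _ ⟨h1, c, hc, rfl⟩ ⟨h2, d, hd, rfl⟩
    exact ⟨mul_mem h1 h2, c * d, fun h => (m.isMaximal.isPrime.mem_or_mem h).elim hc hd, rfl⟩

variable {F : FormRing R} {m : MaximalSpectrum (Subring.center R)}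

/-- Multiplication by `s̄ s` is `a ↦ s̄ a s`, which preserves `Λ`, so norms are admissible scalars.
-/
lemma normLoc_mem (s : locSet m) : (((normLoc s : locSet m) : Subring.center R) : R) ∈
    scalarsOutside F m := by
  refine ⟨⟨(normLoc s).1.2, ?_, fun a ha => ?_⟩, _, (normLoc s).2.1, rfl⟩
  · exact congrArg (fun x : locSet m => ((x : Subring.center R) : R)) (starLoc_normLoc s)
  · rw [← smul_eq, normLoc_smul]
    exact F.conj_mem _ _ ha

lemma isFormLoc_toLoc (F : FormRing R) (m : MaximalSpectrum (Subring.center R)) :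
    IsFormLoc F (F.loc m) (scalarsOutside F m) (toLoc m) where
  map_star a := by
    have h1 : starLoc (1 : locSet m) = 1 :=
      Subtype.ext (Subtype.ext (by simp [starLoc, starCenter]))
    change LocalizedModule.mk (star a) 1 = star (LocalizedModule.mk a 1)
    rw [star_mk, h1]
  map_lam := rfl
  map_mem a ha := by
    have h1 : normLoc (1 : locSet m) = 1 :=
      Subtype.ext (Subtype.ext (by simp [normLoc, starLoc, starCenter]))
    exact ⟨a, ha, 1, by rw [h1]; rfl⟩
  le s hs := hs.1
  map_le := by
    rintro _ ⟨hs, c, hc, rfl⟩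
    refine ⟨Subring.mem_center_iff.2 fun x => ?_, ?_, ?_⟩
    · induction x using LocalizedModule.induction_on with
      | h a s =>
        change LocalizedModule.mk a s * LocalizedModule.mk (c : R) 1 =
          LocalizedModule.mk (c : R) 1 * LocalizedModule.mk a s
        rw [LocalizedModule.mk_mul_mk, LocalizedModule.mk_mul_mk, one_mul, mul_one,
          FormRing.scalars_comm hs]
    · have h1 : starLoc (1 : locSet m) = 1 :=
        Subtype.ext (Subtype.ext (by simp [starLoc, starCenter]))
      change star (LocalizedModule.mk (c : R) 1) = LocalizedModule.mk (c : R) 1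
      rw [star_mk, h1, hs.2.1]
    · rintro _ ⟨a, ha, s, rfl⟩
      refine ⟨c * a, hs.2.2 _ ha, s, ?_⟩
      change LocalizedModule.mk (c : R) 1 * LocalizedModule.mk a _ = _
      rw [LocalizedModule.mk_mul_mk, one_mul]
  exists_of_map_eq_zero a ha := by
    change LocalizedModule.mk a (1 : locSet m) = 0 at ha
    rw [← LocalizedModule.zero_mk (1 : locSet m), LocalizedModule.mk_eq] at ha
    obtain ⟨u, hu⟩ := ha
    refine ⟨_, normLoc_mem u, ?_⟩
    rw [one_smul, one_smul, smul_zero] at hu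
    rw [← smul_eq, normLoc, mul_smul, hu, smul_zero]
  surj b := by
    have key : ∀ (a : R) (s t : locSet m), toLoc m ((((t * s : locSet m) : Subring.center R) : R)) *
        LocalizedModule.mk a s = toLoc m (t • a) := by
      intro a s t
      change LocalizedModule.mk _ 1 * LocalizedModule.mk a s = LocalizedModule.mk (t • a) 1
      rw [LocalizedModule.mk_mul_mk, one_mul, ← smul_eq, mul_comm t s, mul_smul]
      rw [LocalizedModule.mk_eq]
      exact ⟨1, by simp only [one_smul]⟩
    -- A numerator in the right form parameter comes from the definition of `Λ_m`, whose
    -- denominators are already norms. Otherwise a fraction `a / s` is expanded to `s̄ a / (s̄ s)`.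
    by_cases hb : star b ∈ (F.loc m).Λ
    · obtain ⟨a, ha, s, e⟩ := hb
      have hb : b = LocalizedModule.mk (star a) (normLoc s) := by
        rw [← star_star b, e, star_mk, starLoc_normLoc]
      refine ⟨_, normLoc_mem s, star a, ?_, fun _ => by rwa [star_star]⟩
      have := key (star a) (normLoc s) 1
      rw [one_mul, one_smul] at this
      rw [hb, this]
    · induction b using LocalizedModule.induction_on with
      | h a s => exact ⟨_, normLoc_mem s, _, key a s (starLoc s), fun h => absurd h hb⟩

end Base

/-! ### Comparison of the given generators with root elements -/

section Bridge

variable {R : Type*} [Ring R] [StarRing R] {n : ℕ}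

lemma elem_ε (F : FormRing R) (i j : Fin n) (h : i ≠ j) (a : R) :
    elem F (.ε i j h) a = rootT F (Sum.inl i) (Sum.inr j) (star F.lam * a) := by
  ext1
  rw [rootT_val F (by simpa using h.symm)]
  simp only [elem, Idx.nil, rootN, rootX, reduceCtorEq, if_false, FormRing.nu, Sum.elim_inl,
    Sum.elim_inr, Sum.swap_inl, Sum.swap_inr, FormRing.tw, star_mul, star_star, mul_one]
  rw [← F.lam_comm, ← mul_assoc, F.lam_mul_star, one_mul, ← F.lam_comm, F.star_mul_lam_mul]

lemma elem_r (F : FormRing R) (i j : Fin n) (a : R) :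
    elem F (.r i j) a = rootT F (Sum.inl i) (Sum.inl j) a := by
  ext1
  rw [rootT_val F (by simp)]
  by_cases h : i = j
  · subst h
    simp [elem, Idx.nil, rootN, rootX, FormRing.nu]
  · simp [elem, Idx.nil, rootN, rootX, FormRing.nu, h, FormRing.tw]

lemma elem_l (F : FormRing R) (i j : Fin n) (a : R) :
    elem F (.l i j) a = rootT F (Sum.inr i) (Sum.inr j) (star F.lam * a) := by
  have e : star F.lam * a * F.lam = a := by
    rw [← F.lam_comm, ← mul_assoc, F.lam_mul_star, one_mul]
  ext1
  rw [rootT_val F (by simp)]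
  by_cases h : i = j
  · subst h
    simp [elem, Idx.nil, rootN, rootX, FormRing.nu, e]
  · have e2 : star F.lam * (star a * F.lam) * F.lam = F.lam * star a := by
      rw [← F.lam_comm, F.lam_mul_star_mul, F.lam_comm]
    simp [elem, Idx.nil, rootN, rootX, FormRing.nu, h, FormRing.tw, e, e2]

lemma star_star_lam_mul_mem (F : FormRing R) {a : R} (ha : a ∈ F.Λ) :
    star (star F.lam * a) ∈ F.Λ := by
  rw [star_mul, star_star, ← F.lam_comm, ← neg_mem_iff, ← F.eq_of_mem a ha]
  exact ha

lemma exists_elem_eq (F : FormRing R) (p : Idx n) : ∃ (i j : Fin n ⊕ Fin n) (c : R), j ≠ i.swap ∧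
    ∀ a, elem F p a = rootT F i j (c * a) ∧ (a ∈ p.arg F → i = j → star (c * a) ∈ F.Λ) := by
  cases p with
  | ε i j h =>
    exact ⟨_, _, _, by simpa using h.symm, fun a => ⟨elem_ε F i j h a, fun _ e => by simp at e⟩⟩
  | r i j =>
    refine ⟨Sum.inl i, Sum.inl j, 1, by simp, fun a => ⟨by rw [elem_r, one_mul], fun h e => ?_⟩⟩
    rw [one_mul]
    exact h (Sum.inl_injective e)
  | l i j =>
    exact ⟨Sum.inr i, Sum.inr j, star F.lam, by simp, fun a => ⟨elem_l F i j a, fun h e =>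
      star_star_lam_mul_mem F (h (Sum.inr_injective e))⟩⟩

lemma conjGrp_le_relEQ (F : FormRing R) {J : TwoSidedIdeal R} {hJ : ∀ a ∈ J, star a ∈ J} :
    conjGrp F J hJ (n := n) (fun _ _ => True) ≤ relEQ F n J := by
  refine (Subgroup.closure_le _).2 ?_
  rintro _ ⟨i, j, x, a, hp, hx, ha, -, rfl⟩
  have hx' := hx.2
  have ha' : a ∈ J := ha.1
  have has : star a ∈ J := hJ _ ha.1
  have haΛ : i = j → star a ∈ F.Λ := fun e => (ha.2 e).2
  have e1 : ∀ a, star F.lam * (F.lam * a) = a := F.star_mul_lam_mul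
  have e2 : ∀ x, -F.tw x = star F.lam * -star x := fun x => by rw [FormRing.tw, mul_neg]
  have e3 : ∀ {x}, star x ∈ F.Λ → F.lam * x ∈ F.Λ := fun {x} h => by
    have := F.eq_of_mem _ h
    rw [star_star, eq_neg_iff_add_eq_zero, add_comm, ← eq_neg_iff_add_eq_zero] at this
    rw [this]
    exact neg_mem h
  refine Subgroup.subset_closure ?_
  -- `Idx.opp` transposes the indices whereas `conjGrp` keeps their order, so in each case one of
  -- the two root elements is flipped.
  rcases i with i | i <;> rcases j with j | j
  · refine ⟨.l j i, -star x, a, fun e => neg_mem (hx' (by rw [e])), fun e => haΛ (by rw [e]),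
      ha', ?_⟩
    rw [elem_l, Idx.opp, elem_r, ← e2, ← rootT_flip' F (i := Sum.inr i)]
    · rfl
    · intro e; exact hx' (by rw [Sum.inr_injective e])
  · have hij : i ≠ j := fun e => hp (by rw [e]; rfl)
    refine ⟨.ε j i hij.symm, -star x, F.lam * a, trivial, trivial, J.mul_mem_left _ _ ha', ?_⟩
    rw [elem_ε, Idx.opp, elem_ε, e1, ← e2, ← rootT_flip F (i := Sum.inr i) (by simp)]
    rfl
  · have hij : i ≠ j := fun e => hp (by rw [e]; rfl)
    refine ⟨.ε i j hij, F.lam * x, -star a, trivial, trivial, neg_mem has, ?_⟩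
    rw [elem_ε, Idx.opp, elem_ε, e1, ← e2, ← rootT_flip F (i := Sum.inr i) (by simp)]
    rfl
  · refine ⟨.r j i, -F.tw x, F.lam * a, fun e => star_neg_tw_mem F (hx' (by rw [e])),
      fun e => e3 (haΛ (by rw [e])), J.mul_mem_left _ _ ha', ?_⟩
    rw [elem_r, Idx.opp, elem_l, e1, ← rootT_flip' F (i := Sum.inl i)]
    · rfl
    · intro e; exact hx' (by rw [Sum.inl_injective e])

variable {E : Type*} [Ring E] [StarRing E]

/-- The maps `p` and `q` stand for the two projections of the double. With `x` lifted to `(x, x)`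
and `a` to `(a, 0)`, a relative generator lifts to a conjugate that becomes trivial under `q`. -/
lemma exists_lift_of_mem_relEQ {F : FormRing R} {G : FormRing E} {p q : E →+* R}
    (hp : IsFormHom G F p) (hq : IsFormHom G F q) {J : TwoSidedIdeal R}
    (hx : ∀ x, ∃ y, p y = x ∧ q y = x ∧ (star x ∈ F.Λ → star y ∈ G.Λ))
    (ha : ∀ a ∈ J, ∃ y, p y = a ∧ q y = 0 ∧ (star a ∈ F.Λ → star y ∈ G.Λ))
    {g : GL (Fin n ⊕ Fin n) R} (hg : g ∈ relEQ F n J) :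
    ∃ h ∈ eqGrp G n, glMap p h = g ∧ glMap q h = 1 := by
  refine Subgroup.closure_induction (p := fun g _ => ∃ h ∈ eqGrp G n, glMap p h = g ∧
    glMap q h = 1) ?_ ?_ ?_ ?_ hg
  · rintro _ ⟨r, x, a, hxr, har, haJ, rfl⟩
    obtain ⟨i, j, c, hij, h1⟩ := exists_elem_eq F r
    obtain ⟨k, l, d, hkl, h2⟩ := exists_elem_eq F r.opp
    obtain ⟨y, py, qy, hy⟩ := hx (c * x)
    obtain ⟨z, pz, qz, hz⟩ := ha (d * a) (J.mul_mem_left _ _ haJ)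
    refine ⟨rootT G i j y * rootT G k l z * (rootT G i j y)⁻¹, ?_, ?_, ?_⟩
    · have h3 : rootT G i j y ∈ eqGrp G n :=
        Level.rootT_mem_grp ⟨trivial, fun e => hy ((h1 x).2 hxr e)⟩ fun _ => trivial
      have h4 : rootT G k l z ∈ eqGrp G n :=
        Level.rootT_mem_grp ⟨trivial, fun e => hz ((h2 a).2 har e)⟩ fun _ => trivial
      exact mul_mem (mul_mem h3 h4) (inv_mem h3)
    · rw [map_mul, map_mul, map_inv, glMap_rootT hp, glMap_rootT hp, py, pz, (h1 x).1, (h2 a).1]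
    · rw [map_mul, map_mul, map_inv, glMap_rootT hq, glMap_rootT hq, qy, qz, rootT_zero, mul_one,
        mul_inv_cancel]
  · exact ⟨1, one_mem _, map_one _, map_one _⟩
  · rintro g g' _ _ ⟨h, hh, e1, e2⟩ ⟨h', hh', e1', e2'⟩
    exact ⟨h * h', mul_mem hh hh', by rw [map_mul, e1, e1'], by rw [map_mul, e2, e2', mul_one]⟩
  · rintro g _ ⟨h, hh, e1, e2⟩
    exact ⟨h⁻¹, inv_mem hh, by rw [map_inv, e1], by rw [map_inv, e2, inv_one]⟩

end Bridge

/-! ### Polynomial matrices over the double -/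

section DoublePoly

variable {R : Type*} [Ring R] [StarRing R] {n : ℕ} {J : TwoSidedIdeal R}
  {hJ : ∀ a ∈ J, star a ∈ J} {F : FormRing R}

lemma exists_pair (u v : R[X]) (h : ∀ k, u.coeff k - v.coeff k ∈ J) :
    ∃ y : (double J hJ)[X], (∀ k, (y.coeff k : R × R) = (u.coeff k, v.coeff k)) ∧
      mapRingHom (fstHom J hJ) y = u ∧ mapRingHom (sndHom J hJ) y = v := by
  classical
  let y : (double J hJ)[X] := ∑ k ∈ u.support ∪ v.support, monomial k ⟨(u.coeff k, v.coeff k), h k⟩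
  have hy : ∀ k, (y.coeff k : R × R) = (u.coeff k, v.coeff k) := by
    intro k
    simp only [y, finsetSum_coeff, coeff_monomial, Finset.sum_ite_eq']
    split_ifs with hk
    · rfl
    · simp only [Finset.mem_union, mem_support_iff, not_or, not_not] at hk
      rw [hk.1, hk.2]; rfl
  refine ⟨y, hy, ?_, ?_⟩
  · ext k
    rw [coe_mapRingHom, coeff_map]
    exact congrArg Prod.fst (hy k)
  · ext k
    rw [coe_mapRingHom, coeff_map]
    exact congrArg Prod.snd (hy k)

lemma double_poly_ext {x y : (double J hJ)[X]}
    (h1 : mapRingHom (fstHom J hJ) x = mapRingHom (fstHom J hJ) y)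
    (h2 : mapRingHom (sndHom J hJ) x = mapRingHom (sndHom J hJ) y) : x = y := by
  ext k : 1
  refine double_ext ?_ ?_
  · simpa using congrArg (fun p => coeff p k) h1
  · simpa using congrArg (fun p => coeff p k) h2

/-- The inverse of `g` is also congruent to `1` modulo the ideal, so both matrices can be paired
with `1`; the two lifts are inverse because the projections are jointly injective. -/
lemma exists_glMap_eq (g : GL (Fin n ⊕ Fin n) R[X]) (hg : ∀ i j, g.val i j -
      (1 : Matrix (Fin n ⊕ Fin n) (Fin n ⊕ Fin n) R[X]) i j ∈ J.map C) :
    ∃ h : GL (Fin n ⊕ Fin n) (double J hJ)[X], glMap (mapRingHom (fstHom J hJ)) h = g ∧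
      glMap (mapRingHom (sndHom J hJ)) h = 1 := by
  have hg' : ∀ i j, (g⁻¹).val i j -
      (1 : Matrix (Fin n ⊕ Fin n) (Fin n ⊕ Fin n) R[X]) i j ∈ J.map C := by
    intro i j
    have e : (g⁻¹).val - 1 = -((g⁻¹).val * (g.val - 1)) := by
      rw [mul_sub, mul_one, g.inv_mul]; abel
    rw [← Matrix.sub_apply, e, Matrix.neg_apply, Matrix.mul_apply]
    exact neg_mem (sum_mem fun k _ => TwoSidedIdeal.mul_mem_left _ _ _ (hg k j))
  have lift : ∀ A : Matrix (Fin n ⊕ Fin n) (Fin n ⊕ Fin n) R[X],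
      (∀ i j, A i j - (1 : Matrix (Fin n ⊕ Fin n) (Fin n ⊕ Fin n) R[X]) i j ∈ J.map C) →
      ∃ B : Matrix (Fin n ⊕ Fin n) (Fin n ⊕ Fin n) (double J hJ)[X],
        (mapRingHom (fstHom J hJ)).mapMatrix B = A ∧ (mapRingHom (sndHom J hJ)).mapMatrix B = 1 := by
    intro A hA
    choose y hy using fun i j => exists_pair (J := J) (hJ := hJ) (A i j)
      ((1 : Matrix (Fin n ⊕ Fin n) (Fin n ⊕ Fin n) R[X]) i j) fun k => by
        rw [← coeff_sub]; exact coeff_mem_of_mem_map_C (hA i j) k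
    exact ⟨Matrix.of y, Matrix.ext fun i j => (hy i j).2.1, Matrix.ext fun i j => (hy i j).2.2⟩
  have ext : ∀ A B : Matrix (Fin n ⊕ Fin n) (Fin n ⊕ Fin n) (double J hJ)[X],
      (mapRingHom (fstHom J hJ)).mapMatrix A = (mapRingHom (fstHom J hJ)).mapMatrix B →
      (mapRingHom (sndHom J hJ)).mapMatrix A = (mapRingHom (sndHom J hJ)).mapMatrix B → A = B :=
    fun A B h1 h2 => Matrix.ext fun i j => double_poly_ext
      (congrFun (congrFun h1 i) j) (congrFun (congrFun h2 i) j)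
  obtain ⟨A, hA1, hA2⟩ := lift g.val hg
  obtain ⟨B, hB1, hB2⟩ := lift (g⁻¹).val hg'
  refine ⟨⟨A, B, ?_, ?_⟩, Units.ext hA1, Units.ext hA2⟩
  · refine ext _ _ ?_ ?_
    · rw [map_mul, hA1, hB1, g.mul_inv, map_one]
    · rw [map_mul, hA2, hB2, map_one, mul_one]
  · refine ext _ _ ?_ ?_
    · rw [map_mul, hA1, hB1, g.inv_mul, map_one]
    · rw [map_mul, hA2, hB2, map_one, mul_one]

/-- Appending a root element with projections `u`, `v` to `g` multiplies the expression on the right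
by the conjugate, under the second projection of `g`, of the root element with argument `u - v`.
This argument lies in the ideal, and normality finishes the induction. -/
lemma fst_mul_snd_inv_mem (hn : 3 ≤ n) {g : GL (Fin n ⊕ Fin n) (double J hJ)[X]}
    (hg : g ∈ eqGrp (F.double hJ).poly n) :
    glMap (mapRingHom (fstHom J hJ)) g * (glMap (mapRingHom (sndHom J hJ)) g)⁻¹ ∈
      relEQ F.poly n (J.map C) := by
  refine conjGrp_le_relEQ F.poly (hJ := star_mem_map_C hJ) (Level.grp_induction (p := fun g =>
    glMap (mapRingHom (fstHom J hJ)) g * (glMap (mapRingHom (sndHom J hJ)) g)⁻¹ ∈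
      conjGrp F.poly (J.map C) (star_mem_map_C hJ) (fun _ _ => True)) ?_ ?_ hg)
  · simp [one_mem]
  · intro g i j a hg hp ha _ ih
    have h1 := isFormHom_map (isFormHom_fst (F := F) (hJ := hJ))
    have h2 := isFormHom_map (isFormHom_snd (F := F) (hJ := hJ))
    rw [map_mul, map_mul, glMap_rootT h1, glMap_rootT h2]
    set u := mapRingHom (fstHom J hJ) a
    set v := mapRingHom (sndHom J hJ) a
    have huv : u - v ∈ J.map C := mem_map_C_of_coeff_mem fun k => by
      simp only [u, v, coeff_sub, coe_mapRingHom, coeff_map]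
      exact (a.coeff k).2
    have hadm : (Level.ofIdeal F.poly (J.map C) (star_mem_map_C hJ)).Adm i j (u - v) :=
      ⟨huv, fun e => ⟨huv, by
        change star (u - v) ∈ F.poly.Λ
        rw [star_sub]
        exact sub_mem (h1.star_mem (ha.2 e)) (h2.star_mem (ha.2 e))⟩⟩
    have := mul_mem ih (conjGrp_normal hn (h2.map_eqGrp hg)
      (grp_le_conjGrp (Level.rootT_mem_grp (Φ := fun _ _ => True) hadm fun _ => trivial)))
    rw [sub_eq_add_neg, rootT_add, rootT_neg] at this
    convert this using 1
    group

end DoublePoly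

/-! ### Integrality of the centre over the scalars -/

section Centre

variable {R : Type*} [Ring R] [StarRing R]

/-- The scalars, as a subring of the centre. -/
def centralScalars (F : FormRing R) : Subring (Subring.center R) :=
  F.scalars.comap (Subring.center R).subtype

lemma norm_mem_scalars (F : FormRing R) (c : Subring.center R) :
    star (c : R) * c ∈ F.scalars := by
  refine ⟨mul_mem (Set.star_mem_center c.2) c.2, by rw [star_mul, star_star], fun a ha => ?_⟩
  rw [mul_assoc, ← Subring.mem_center_iff.1 c.2 a, ← mul_assoc]
  exact F.conj_mem _ _ ha

/-- The trace is a combination of norms: `c̄ + c = N(1 + c) - N(c) - 1`. -/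
lemma trace_mem_scalars (F : FormRing R) (c : Subring.center R) :
    star (c : R) + c ∈ F.scalars := by
  have h := sub_mem (sub_mem (norm_mem_scalars F (1 + c)) (norm_mem_scalars F c)) (one_mem _)
  convert h using 1
  simp only [Subring.coe_add, Subring.coe_one, star_add, star_one]
  noncomm_ring

lemma isIntegral_of_sq_eq {A B : Type*} [CommRing A] [CommRing B] [Algebra A B] {c : B} (t d : A)
    (h : c ^ 2 = algebraMap A B t * c - algebraMap A B d) : IsIntegral A c := by
  refine ⟨X ^ (1 + 1) - (C t * X - C d), monic_X_pow_sub ?_, ?_⟩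
  · refine (degree_sub_le _ _).trans_lt (max_lt ((degree_C_mul_X_le t).trans_lt ?_)
      (degree_C_le.trans_lt ?_)) <;> norm_num
  · rw [eval₂_sub, eval₂_sub, eval₂_mul, eval₂_pow, eval₂_X, eval₂_C, eval₂_C, one_add_one_eq_two,
      h, sub_self]

/-- Each `c` is a root of `X² - (c̄ + c) X + c̄ c`, whose coefficients are scalars. -/
instance isIntegral_center (F : FormRing R) :
    Algebra.IsIntegral (centralScalars F) (Subring.center R) where
  isIntegral c := by
    refine isIntegral_of_sq_eq
      ⟨⟨star (c : R) + c, (trace_mem_scalars F c).1⟩, trace_mem_scalars F c⟩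
      ⟨⟨star (c : R) * c, (norm_mem_scalars F c).1⟩, norm_mem_scalars F c⟩ (Subtype.ext ?_)
    change (c : R) ^ 2 = (star (c : R) + c) * c - star (c : R) * c
    noncomm_ring

end Centre

end QuadraticGroup

/-! ### The relative local-global principle -/

open QuadraticGroup in
theorem mainTheorem12 {R : Type*} [Ring R] [StarRing R] [Module.Finite (Subring.center R) R]
    (F : QuadraticGroup.FormRing R) (n : ℕ) (hn : 3 ≤ n)
    (J : TwoSidedIdeal R) (hJ : ∀ a ∈ J, star a ∈ J)
    (α : Matrix.GeneralLinearGroup (Fin n ⊕ Fin n) (Polynomial R))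
    (hα : α ∈ QuadraticGroup.relGQ F.poly n (J.map Polynomial.C))
    (hα0 : α.val.map (Polynomial.eval 0) = 1)
    (hloc : ∀ m : MaximalSpectrum (Subring.center R),
      Units.map (Polynomial.mapRingHom (QuadraticGroup.toLoc m)).mapMatrix.toMonoidHom α ∈
        QuadraticGroup.relEQ (F.loc m).poly n
          ((J.map (QuadraticGroup.toLoc m)).map Polynomial.C)) :
    α ∈ QuadraticGroup.relEQ F.poly n (J.map Polynomial.C) := by
  obtain ⟨β, hβ1, hβ2⟩ := exists_glMap_eq (hJ := hJ) α hα.2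
  have hα1 : glMap (cst F) α = 1 := by
    refine Units.ext (Matrix.ext fun i j => ?_)
    change cst F (α.val i j) = (1 : Matrix (Fin n ⊕ Fin n) (Fin n ⊕ Fin n) R[X]) i j
    have h := congrFun (congrFun hα0 i) j
    rw [Matrix.map_apply] at h
    rw [cst_eq, coeff_zero_eq_eval_zero, h, Matrix.one_apply, Matrix.one_apply, apply_ite C, C_1,
      C_0]
  have hβ0 : glMap (cst (F.double hJ)) β = 1 := by
    refine glMap_ext (f := mapRingHom (fstHom J hJ)) (g := mapRingHom (sndHom J hJ))
      (fun a b => double_poly_ext) ?_ ?_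
    · rw [glMap_glMap, map_comp_cst (G := F), ← glMap_glMap, hβ1, hα1, map_one]
    · rw [glMap_glMap, map_comp_cst (G := F), ← glMap_glMap, hβ2, map_one, map_one]
  let ι : centralScalars F →+* (F.double hJ).scalars :=
    ((diagHom J hJ).comp ((Subring.center R).subtype.comp (centralScalars F).subtype)).codRestrict
      (F.double hJ).scalars fun a => diag_mem_scalars a.2
  have hβ : β ∈ eqGrp (F.double hJ).poly n := by
    refine mem_eqGrp_of_local ι hβ0 fun P hP => ?_
    -- Patching runs over maximal ideals `P` of the scalars, whereas local membership is given at
    -- those of the centre. Lying over supplies `Q` above `P`.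
    obtain ⟨Q, hQ, hQP⟩ := Ideal.exists_ideal_over_maximal_of_isIntegral (S := Subring.center R) P
      (by
        rw [(RingHom.injective_iff_ker_eq_bot _).1 Subtype.val_injective]
        exact bot_le)
    let m : MaximalSpectrum (Subring.center R) := ⟨Q, hQ⟩
    have hl := isFormLoc_toLoc F m
    have hJ' := hl.star_mem_map hJ
    -- The local image of `β` has projections `α_m` and `1`. The lift `γ` of the relative elementary
    -- matrix `α_m` has the same projections, so the two coincide.
    have hφ : glMap (mapRingHom (doubleMap (toLoc m) hJ hJ')) β ∈
        eqGrp ((F.loc m).double hJ').poly n := by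
      obtain ⟨γ, hγ, e1, e2⟩ := exists_lift_of_mem_relEQ (G := ((F.loc m).double hJ').poly)
        (isFormHom_map isFormHom_fst) (isFormHom_map isFormHom_snd) (fun x => by
          obtain ⟨y, hy, y1, y2⟩ := exists_pair (hJ := hJ') x x fun k => by
            rw [sub_self]; exact zero_mem _
          refine ⟨y, y1, y2, fun hx => ?_⟩
          rw [FormRing.star_mem_poly_Λ] at hx ⊢
          intro k
          change star (y.coeff k : Loc m × Loc m).1 ∈ _ ∧ star (y.coeff k : Loc m × Loc m).2 ∈ _
          rw [hy]
          exact ⟨hx k, hx k⟩) (fun a ha => by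
          obtain ⟨y, hy, y1, y2⟩ := exists_pair (hJ := hJ') a 0 fun k => by
            rw [coeff_zero, sub_zero]; exact coeff_mem_of_mem_map_C ha k
          refine ⟨y, y1, y2, fun hx => ?_⟩
          rw [FormRing.star_mem_poly_Λ] at hx ⊢
          intro k
          change star (y.coeff k : Loc m × Loc m).1 ∈ _ ∧ star (y.coeff k : Loc m × Loc m).2 ∈ _
          rw [hy]
          exact ⟨hx k, by simp [zero_mem]⟩) (hloc m)
      convert hγ
      refine glMap_ext (f := mapRingHom (fstHom _ hJ')) (g := mapRingHom (sndHom _ hJ'))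
        (fun a b => double_poly_ext) ?_ ?_
      · rw [e1, glMap_glMap]
        have : (mapRingHom (fstHom _ hJ')).comp (mapRingHom (doubleMap (toLoc m) hJ hJ')) =
            (mapRingHom (toLoc m)).comp (mapRingHom (fstHom J hJ)) :=
          Polynomial.ringHom_ext (fun a => by simp; rfl) (by simp)
        rw [this, ← glMap_glMap, hβ1]
        rfl
      · rw [e2, glMap_glMap]
        have : (mapRingHom (sndHom _ hJ')).comp (mapRingHom (doubleMap (toLoc m) hJ hJ')) =
            (mapRingHom (toLoc m)).comp (mapRingHom (sndHom J hJ)) :=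
          Polynomial.ringHom_ext (fun a => by simp; rfl) (by simp)
        rw [this, ← glMap_glMap, hβ2, map_one]
    obtain ⟨s, ⟨_, ⟨hc, c, hcm, rfl⟩, hs⟩, h⟩ := (hl.double hJ hJ').exists_congruent hn hφ
    -- The scalar found lies outside `Q`, hence outside its contraction `P`.
    refine ⟨⟨c, hc⟩, fun hcP => hcm ?_, fun a b => ?_⟩
    · rw [← hQP] at hcP
      exact hcP
    · have e : ι ⟨c, hc⟩ = s := Subtype.ext hs
      rw [map_add, map_mul, e]
      exact h _ _
  have := fst_mul_snd_inv_mem hn hβ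
  rwa [hβ1, hβ2, inv_one, mul_one] at this

end
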